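/- Let $p>1$ be real and let $G$ be a countably infinite, connected graph of bounded degree without self-loops, with vertex set $V$ and a fixed vertex $o$; $N_x$ is the set of neighbours of $x$. For $f:V\to\mathbb R$ put $I_p(f,V)=\sum_{x\in V}\sum_{y\in N_x}|f(y)-f(x)|^p$ and $\Delta_pf(x)=\sum_{y\in N_x}|f(y)-f(x)|^{p-2}(f(y)-f(x))$ (terms with $f(y)=f(x)$ are $0$); $f$ is $p$-harmonic if $\Delta_pf=0$ on $V$. Let $D_p(G)=\{f: I_p(f,V)<\infty\}$ with norm $(I_p(f,V)+|f(o)|^p)^{1/p}$, and let $BD_p(G)$ be the algebra of bounded functions in $D_p(G)$. Let $Sp(BD_p(G))$ be the set of nonzero algebra homomorphisms $\tau:BD_p(G)\to\mathbb C$ with the weak-$*$ topology, write $\hat f(\tau)=\tau(f)$, and regard $V$ as a subset of it through $x\mapsto(f\mapsto f(x))$. The $p$-harmonic boundary $\partial_p(G)$ is the set of $\tau\in Sp(BD_p(G))\setminus V$ such that $\hat f(\tau)=0$ for every bounded $f$ in the closure in $D_p(G)$ of the finitely supported functions. A function $h:V\to\mathbb R$ has the value $a\in\mathbb R$ at $\tau\in\partial_p(G)$,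 written $h(\tau)=a$, if $h(v)\to a$ as $v\in V$ tends to $\tau$ in $Sp(BD_p(G))$; for $h\in BD_p(G)$ this value exists and is $\hat h(\tau)$. Suppose that $\partial_p(G)$ is finite, $\partial_p(G)=\{x_1,\dots,x_n\}$ with the $x_i$ distinct. Then: 1. For all $a_1,\dots,a_n\in\mathbb R$ there is a bounded $p$-harmonic function $h$ on $V$, which moreover lies in $BD_p(G)$, such that $h(x_i)=\hat h(x_i)=a_i$ for $i=1,\dots,n$. 2. Conversely, if $n\ge 1$, then a bounded $p$-harmonic function is uniquely determined by its values at $x_1,\dots,x_n$: if $h_1,h_2\in BD_p(G)$ are $p$-harmonic and $\hat h_1(x_i)=\hat h_2(x_i)$ for all $i$, then $h_1=h_2$; more generally, if $h_1,h_2$ are any bounded $p$-harmonic functions on $V$ that have values at all $x_i$, and $h_1(x_i)=h_2(x_i)$ for all $i$, then $h_1=h_2$. -/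

import Mathlib

noncomputable section

namespace PRoyden

open Filter Topology

variable {V : Type*} (G : SimpleGraph V) [G.LocallyFinite]

/-- Bounded degree: some positive integer bounds the number of neighbours of every vertex. -/
def BoundedDegree : Prop := ∃ k : ℕ, 0 < k ∧ ∀ x : V, G.degree x ≤ k

/-- The `p`-th power of the gradient, `|Df(x)|^p = ∑_{y ∈ N_x} |f(y) - f(x)|^p`. -/
def gradPow (p : ℝ) (f : V → ℝ) (x : V) : ℝ :=
  ∑ y ∈ G.neighborFinset x, |f y - f x| ^ p

/-- The `p`-Laplacian `Δ_p f(x) = ∑_{y ∈ N_x} |f(y) - f(x)|^(p-2) (f(y) - f(x))`; the summand is `0`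
when `f(y) = f(x)`, also for `p < 2`. -/
def pLaplacian (p : ℝ) (f : V → ℝ) (x : V) : ℝ :=
  ∑ y ∈ G.neighborFinset x, |f y - f x| ^ (p - 2) * (f y - f x)

/-- `f` is `p`-harmonic on `V`. -/
def IsPHarmonic (p : ℝ) (f : V → ℝ) : Prop := ∀ x : V, pLaplacian G p f x = 0

/-- `f` is a bounded function. -/
def IsBdd (f : V → ℝ) : Prop := ∃ C : ℝ, ∀ x : V, |f x| ≤ C

/-- `f` is `p`-Dirichlet finite, `I_p(f, V) < ∞` (a series of nonnegative terms). -/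
def DirichletFinite (p : ℝ) (f : V → ℝ) : Prop := Summable (gradPow G p f)

/-- The `p`-Dirichlet sum `I_p(f, V)` (used for Dirichlet finite `f` only). -/
def dirichletSum (p : ℝ) (f : V → ℝ) : ℝ := ∑' x : V, gradPow G p f x

/-- The norm `(I_p(f, V) + |f(o)|^p)^(1/p)` of the space `D_p(G)`. -/
def dpNorm (p : ℝ) (o : V) (f : V → ℝ) : ℝ :=
  (dirichletSum G p f + |f o| ^ p) ^ (1 / p)

/-- The closure in `D_p(G)` of the set of finitely supported functions. -/
def finSuppClosure (p : ℝ) (o : V) : Set (V → ℝ) :=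
  {f | DirichletFinite G p f ∧
    ∀ ε : ℝ, 0 < ε → ∃ g : V → ℝ, (Function.support g).Finite ∧ dpNorm G p o (f - g) < ε}

lemma gradPow_nonneg (p : ℝ) (f : V → ℝ) (x : V) : 0 ≤ gradPow G p f x :=
  Finset.sum_nonneg fun _ _ => Real.rpow_nonneg (abs_nonneg _) _

lemma rpow_le_of_le_add {p : ℝ} (hp : 0 < p) {c a b : ℝ} (hc : 0 ≤ c) (ha : 0 ≤ a) (hb : 0 ≤ b)
    (h : c ≤ a + b) : c ^ p ≤ 2 ^ p * (a ^ p + b ^ p) := by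
  have ha' := Real.rpow_nonneg ha p
  have hb' := Real.rpow_nonneg hb p
  have h2 : (0 : ℝ) ≤ 2 ^ p := Real.rpow_nonneg (by norm_num) p
  rcases le_total a b with hab | hab
  · calc c ^ p ≤ (2 * b) ^ p := Real.rpow_le_rpow hc (by linarith) hp.le
      _ = 2 ^ p * b ^ p := Real.mul_rpow (by norm_num) hb
      _ ≤ _ := mul_le_mul_of_nonneg_left (by linarith) h2
  · calc c ^ p ≤ (2 * a) ^ p := Real.rpow_le_rpow hc (by linarith) hp.le
      _ = 2 ^ p * a ^ p := Real.mul_rpow (by norm_num) ha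
      _ ≤ _ := mul_le_mul_of_nonneg_left (by linarith) h2

lemma gradPow_le {p : ℝ} (hp : 0 < p) {f g k : V → ℝ} {A B : ℝ} (hA : 0 ≤ A) (hB : 0 ≤ B)
    (h : ∀ x y, |k y - k x| ≤ A * |f y - f x| + B * |g y - g x|) (x : V) :
    gradPow G p k x ≤ 2 ^ p * (A ^ p * gradPow G p f x + B ^ p * gradPow G p g x) := by
  unfold gradPow
  rw [Finset.mul_sum, Finset.mul_sum, ← Finset.sum_add_distrib, Finset.mul_sum]
  refine Finset.sum_le_sum fun y _ => ?_
  have := rpow_le_of_le_add hp (abs_nonneg _) (mul_nonneg hA (abs_nonneg (f y - f x)))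
    (mul_nonneg hB (abs_nonneg (g y - g x))) (h x y)
  rwa [Real.mul_rpow hA (abs_nonneg _), Real.mul_rpow hB (abs_nonneg _)] at this

lemma DirichletFinite.of_le {p : ℝ} (hp : 0 < p) {f g k : V → ℝ} (hf : DirichletFinite G p f)
    (hg : DirichletFinite G p g) {A B : ℝ} (hA : 0 ≤ A) (hB : 0 ≤ B)
    (h : ∀ x y, |k y - k x| ≤ A * |f y - f x| + B * |g y - g x|) : DirichletFinite G p k :=
  Summable.of_nonneg_of_le (gradPow_nonneg G p k) (gradPow_le G hp hA hB h)
    (((Summable.mul_left (A ^ p) hf).add (Summable.mul_left (B ^ p) hg)).mul_left (2 ^ p))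

/-- The algebra `BD_p(G)` of bounded `p`-Dirichlet finite functions, with pointwise operations. -/
def BD (p : ℝ) (hp : 1 < p) : Subalgebra ℝ (V → ℝ) where
  carrier := {f | DirichletFinite G p f ∧ IsBdd f}
  mul_mem' := by
    rintro f g ⟨hf, a, ha⟩ ⟨hg, b, hb⟩
    refine ⟨DirichletFinite.of_le G (by linarith) hf hg (abs_nonneg b) (abs_nonneg a) ?_,
      |a| * |b|, fun x => ?_⟩
    · intro x y
      have e : (f * g) y - (f * g) x = g y * (f y - f x) + f x * (g y - g x) := by
        simp only [Pi.mul_apply]; ring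
      rw [e]
      refine (abs_add_le _ _).trans ?_
      rw [abs_mul, abs_mul]
      have h1 : |g y| ≤ |b| := (hb y).trans (le_abs_self b)
      have h2 : |f x| ≤ |a| := (ha x).trans (le_abs_self a)
      gcongr
    · have h1 : |f x| ≤ |a| := (ha x).trans (le_abs_self a)
      have h2 : |g x| ≤ |b| := (hb x).trans (le_abs_self b)
      rw [Pi.mul_apply, abs_mul]
      gcongr
  add_mem' := by
    rintro f g ⟨hf, a, ha⟩ ⟨hg, b, hb⟩
    refine ⟨DirichletFinite.of_le G (by linarith) hf hg zero_le_one zero_le_one ?_,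
      a + b, fun x => ?_⟩
    · intro x y
      have e : (f + g) y - (f + g) x = (f y - f x) + (g y - g x) := by
        simp only [Pi.add_apply]; ring
      rw [e, one_mul, one_mul]
      exact abs_add_le _ _
    · exact (abs_add_le _ _).trans (add_le_add (ha x) (hb x))
  algebraMap_mem' := by
    intro r
    refine ⟨?_, |r|, fun x => ?_⟩
    · have : gradPow G p (algebraMap ℝ (V → ℝ) r) = fun _ => 0 := by
        funext x
        simp [gradPow, Real.zero_rpow (by linarith : p ≠ 0)]
      unfold DirichletFinite
      rw [this]
      exact summable_zero
    · simp

/-- The spectrum `Sp(BD_p(G))`: nonzero homomorphisms of the real algebra `BD_p(G)` into `ℂ`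
(a nonzero homomorphism into a field maps `1` to `1`). -/
def Sp (p : ℝ) (hp : 1 < p) : Type _ := BD G p hp →ₐ[ℝ] ℂ

/-- The Gelfand transform, `gelfand f τ = τ(f)`. -/
def gelfand {p : ℝ} {hp : 1 < p} (f : BD G p hp) (τ : Sp G p hp) : ℂ :=
  (show BD G p hp →ₐ[ℝ] ℂ from τ) f

/-- The weak-* topology of the spectrum: the coarsest one for which all Gelfand transforms are
continuous. -/
instance (p : ℝ) (hp : 1 < p) : TopologicalSpace (Sp G p hp) :=
  TopologicalSpace.induced (fun τ (f : BD G p hp) => gelfand G f τ) inferInstance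

/-- The map `i : V → Sp(BD_p(G))`, `i(x)(f) = f(x)`. -/
def evalChar (p : ℝ) (hp : 1 < p) (x : V) : Sp G p hp :=
  (Complex.ofRealAm.comp (Pi.evalAlgHom ℝ (fun _ : V => ℝ) x)).comp (BD G p hp).val

/-- The `p`-Royden boundary `R_p(G) = Sp(BD_p(G)) \ V`. -/
def roydenBoundary (p : ℝ) (hp : 1 < p) : Set (Sp G p hp) :=
  (Set.range (evalChar G p hp))ᶜ

/-- The `p`-harmonic boundary `∂_p(G)`: the points of the `p`-Royden boundary at which the Gelfand
transform of every bounded function in the `D_p(G)`-closure of the finitely supported functions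
vanishes. -/
def harmonicBoundary (p : ℝ) (hp : 1 < p) (o : V) : Set (Sp G p hp) :=
  {τ | τ ∈ roydenBoundary G p hp ∧
    ∀ f : BD G p hp, (f : V → ℝ) ∈ finSuppClosure G p o → gelfand G f τ = 0}

/-- The function `h` on `V` has the value `a` at the point `τ` of the spectrum:
`h(v) → a` as the vertex `v` tends to `τ` in `Sp(BD_p(G))`. -/
def HasValueAt {p : ℝ} {hp : 1 < p} (h : V → ℝ) (τ : Sp G p hp) (a : ℝ) : Prop :=
  Tendsto h (comap (evalChar G p hp) (𝓝 τ)) (𝓝 a)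

end PRoyden

end

/-! Existence is a Royden decomposition. Characters of `BD` are real-valued and finitely many
distinct ones can be interpolated, so some f in `BD` has the prescribed values at the `x i`. A
pointwise limit h of a minimising sequence for the energy over f plus finitely supported functions
is p-harmonic, and h - f is a bounded element of `finSuppClosure`
(`exists_isPHarmonic_sub_mem_finSuppClosure`). The harmonic boundary does not see h - f, so h keeps
the values of f.

For uniqueness, let h₁ be bounded and p-harmonic, possibly of infinite energy, let h be the solution
in `BD` with the same boundary values, and put f = h₁ - h. If {|f| ≥ ε} were not negligible at
infinity, it would carry an ultrafilter whose limit character lies in the harmonic boundary, where f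
tends to 0. Hence some g in `finSuppClosure` equals 1 on that set
(`exists_mem_finSuppClosure_eq_one`).

Finitely supported η_k converging to g in energy, truncated to [0, 1], serve as cutoffs: the
difference of the two equations is tested with (f - ε)⁺ η_k^p. Errors arise only on edges with both
ends in {f > ε}. There g is constant, so the variation of η_k is that of η_k - g, and its
contribution vanishes as k → ∞. The uncontrolled gradient of h₁ is absorbed into the monotone main
term at the price of θ times the energy of h (`exists_edge_estimate`). Letting θ → 0 shows that (f -
ε)⁺ is constant along edges (`max_sub_eq_of_adj`). By symmetry and connectedness f is constant, and
a nonzero constant would put 1 into `finSuppClosure`, which is impossible when the harmonic boundary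
is nonempty.

The functional analysis rests on the weak closedness of `finSuppClosure`
(`mem_finSuppClosure_of_approx`), a consequence of uniform convexity. -/

noncomputable section

namespace PRoyden

open Filter Topology

/-! ### Scalar inequalities: uniform convexity of the p-th power and monotonicity of its derivative.
-/

section Scalar

/-- The midpoint convexity defect of `|·|^p`. -/
def midDefect (p a b : ℝ) : ℝ := (|a| ^ p + |b| ^ p) / 2 - |(a + b) / 2| ^ p

lemma continuous_abs_rpow {p : ℝ} (hp : 0 < p) : Continuous fun a : ℝ => |a| ^ p :=
  continuous_abs.rpow_const fun _ => Or.inr hp.le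

lemma midDefect_nonneg {p : ℝ} (hp : 1 < p) (a b : ℝ) : 0 ≤ midDefect p a b := by
  have h1 : |(a + b) / 2| ^ p ≤ ((1 / 2 : ℝ) * |a| + (1 / 2) * |b|) ^ p := by
    refine Real.rpow_le_rpow (abs_nonneg _) ?_ (by linarith)
    rw [abs_div, abs_two]
    linarith [abs_add_le a b]
  have h2 := (convexOn_rpow hp.le).2 (Set.mem_Ici.2 (abs_nonneg a)) (Set.mem_Ici.2 (abs_nonneg b))
    (show (0 : ℝ) ≤ 1 / 2 by norm_num) (show (0 : ℝ) ≤ 1 / 2 by norm_num) (by norm_num)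
  simp only [smul_eq_mul] at h2
  unfold midDefect
  linarith

lemma midDefect_pos {p : ℝ} (hp : 1 < p) {a b : ℝ} (hab : a ≠ b) : 0 < midDefect p a b := by
  have h0 : |(a + b) / 2| ≤ (1 / 2 : ℝ) * |a| + (1 / 2) * |b| := by
    rw [abs_div, abs_two]
    linarith [abs_add_le a b]
  unfold midDefect
  by_cases h : |a| = |b|
  · rcases abs_eq_abs.1 h with h | h
    · exact absurd h hab
    · subst h
      have hb : b ≠ 0 := fun hb => hab (by simp [hb])
      have : 0 < |b| ^ p := Real.rpow_pos_of_pos (abs_pos.2 hb) p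
      simp [Real.zero_rpow (by linarith : p ≠ 0), this]
  · have h1 : |(a + b) / 2| ^ p ≤ ((1 / 2 : ℝ) * |a| + (1 / 2) * |b|) ^ p :=
      Real.rpow_le_rpow (abs_nonneg _) h0 (by linarith)
    have h2 := (strictConvexOn_rpow hp).2 (Set.mem_Ici.2 (abs_nonneg a))
      (Set.mem_Ici.2 (abs_nonneg b)) h (show (0 : ℝ) < 1 / 2 by norm_num)
      (show (0 : ℝ) < 1 / 2 by norm_num) (by norm_num)
    simp only [smul_eq_mul] at h2
    linarith

lemma midDefect_mul {p : ℝ} {c : ℝ} (hc : 0 ≤ c) (a b : ℝ) :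
    midDefect p (c * a) (c * b) = c ^ p * midDefect p a b := by
  unfold midDefect
  have : (c * a + c * b) / 2 = c * ((a + b) / 2) := by ring
  rw [this]
  simp only [abs_mul, abs_of_nonneg hc, Real.mul_rpow hc (abs_nonneg _)]
  ring

/-- Uniform convexity of `|·|^p` in quantitative, homogeneous form. -/
lemma exists_abs_sub_rpow_le {p : ℝ} (hp : 1 < p) {ε : ℝ} (hε : 0 < ε) :
    ∃ C : ℝ, 0 ≤ C ∧ ∀ a b : ℝ,
      |a - b| ^ p ≤ ε * (|a| ^ p + |b| ^ p) + C * midDefect p a b := by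
  have hp0 : 0 < p := by linarith
  have hc := continuous_abs_rpow hp0
  have hcD : Continuous fun z : ℝ × ℝ => midDefect p z.1 z.2 := by
    unfold midDefect
    exact (((hc.comp continuous_fst).add (hc.comp continuous_snd)).div_const 2).sub
      (hc.comp ((continuous_fst.add continuous_snd).div_const 2))
  have hcN : Continuous fun z : ℝ × ℝ => |z.1| ^ p + |z.2| ^ p :=
    (hc.comp continuous_fst).add (hc.comp continuous_snd)
  have hcd : Continuous fun z : ℝ × ℝ => |z.1 - z.2| ^ p :=
    hc.comp (continuous_fst.sub continuous_snd)
  have hle1 : ∀ a : ℝ, |a| ^ p ≤ 1 → |a| ≤ 1 := fun a ha => by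
    by_contra! h
    exact absurd ha (not_le.2 (Real.one_lt_rpow h hp0))
  -- On normalised pairs away from the diagonal the defect has a positive minimum by compactness.
  -- Since |a - b| ≤ 2 there, 2 ^ p divided by that minimum serves as the constant.
  let K : Set (ℝ × ℝ) := {z | |z.1| ^ p + |z.2| ^ p = 1} ∩ {z | ε ≤ |z.1 - z.2| ^ p}
  have hbd : ∀ z : ℝ × ℝ, |z.1| ^ p + |z.2| ^ p = 1 → |z.1| ≤ 1 ∧ |z.2| ≤ 1 := fun z hz => by
    have h1 := Real.rpow_nonneg (abs_nonneg z.1) p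
    have h2 := Real.rpow_nonneg (abs_nonneg z.2) p
    exact ⟨hle1 _ (by linarith), hle1 _ (by linarith)⟩
  have hK : IsCompact K := by
    refine IsCompact.of_isClosed_subset
      ((isCompact_Icc (a := (-1 : ℝ)) (b := 1)).prod (isCompact_Icc (a := (-1 : ℝ)) (b := 1)))
      ((isClosed_eq hcN continuous_const).inter (isClosed_le continuous_const hcd)) ?_
    rintro z ⟨hz, -⟩
    exact ⟨abs_le.1 (hbd z hz).1, abs_le.1 (hbd z hz).2⟩
  have hunit : ∃ C : ℝ, 0 ≤ C ∧ ∀ a b : ℝ, |a| ^ p + |b| ^ p = 1 →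
      |a - b| ^ p ≤ ε + C * midDefect p a b := by
    rcases K.eq_empty_or_nonempty with hne | hne
    · refine ⟨0, le_rfl, fun a b h => ?_⟩
      by_contra! hlt
      have : ((a, b) : ℝ × ℝ) ∈ K := ⟨h, by simp at hlt; exact hlt.le⟩
      simp [hne] at this
    · obtain ⟨z, hzK, hz⟩ := hK.exists_isMinOn hne hcD.continuousOn
      have hd : 0 < midDefect p z.1 z.2 := by
        refine midDefect_pos hp fun h => ?_
        have := hzK.2
        simp [h, Real.zero_rpow hp0.ne'] at this
        linarith
      refine ⟨2 ^ p / midDefect p z.1 z.2, by positivity, fun a b h => ?_⟩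
      rcases lt_or_ge (|a - b| ^ p) ε with hlt | hge
      · have : 0 ≤ 2 ^ p / midDefect p z.1 z.2 * midDefect p a b :=
          mul_nonneg (by positivity) (midDefect_nonneg hp a b)
        linarith
      · have hm : midDefect p z.1 z.2 ≤ midDefect p a b := hz (a := (a, b)) ⟨h, hge⟩
        have h2 : |a - b| ^ p ≤ 2 ^ p := by
          refine Real.rpow_le_rpow (abs_nonneg _) ?_ hp0.le
          have := hbd (a, b) h
          linarith [abs_sub a b, this.1, this.2]
        have h3 : (2 : ℝ) ^ p ≤ 2 ^ p / midDefect p z.1 z.2 * midDefect p a b := by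
          rw [div_mul_eq_mul_div, le_div_iff₀ hd]
          exact mul_le_mul_of_nonneg_left hm (by positivity)
        linarith
  obtain ⟨C, hC, h⟩ := hunit
  refine ⟨C, hC, fun a b => ?_⟩
  set N := |a| ^ p + |b| ^ p with hN
  have hN0 : 0 ≤ N := by positivity
  rcases hN0.eq_or_lt with h0 | hpos
  · have ha : |a| ^ p = 0 := by
      have h1 := Real.rpow_nonneg (abs_nonneg a) p
      have h2 := Real.rpow_nonneg (abs_nonneg b) p
      linarith
    have hb : |b| ^ p = 0 := by linarith
    have ha' : a = 0 := by simpa using (Real.rpow_eq_zero (abs_nonneg a) hp0.ne').1 ha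
    have hb' : b = 0 := by simpa using (Real.rpow_eq_zero (abs_nonneg b) hp0.ne').1 hb
    have := mul_nonneg hC (midDefect_nonneg hp a b)
    rw [← h0, ha', hb'] at *
    simpa [Real.zero_rpow hp0.ne'] using this
  -- Both sides are homogeneous of degree p, so scaling by c reduces to the normalised case.
  · set c := N ^ (-(1 / p)) with hcdef
    have hc0 : 0 ≤ c := Real.rpow_nonneg hN0 _
    have hcp : c ^ p = N⁻¹ := by
      rw [hcdef, ← Real.rpow_mul hN0]
      rw [show -(1 / p) * p = -1 by field_simp, Real.rpow_neg_one]
    have hscale : ∀ t : ℝ, |c * t| ^ p = N⁻¹ * |t| ^ p := fun t => by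
      rw [abs_mul, abs_of_nonneg hc0, Real.mul_rpow hc0 (abs_nonneg _), hcp]
    have key := h (c * a) (c * b) (by
      rw [hscale, hscale, ← mul_add, ← hN, inv_mul_cancel₀ hpos.ne'])
    rw [← mul_sub, hscale, midDefect_mul hc0, hcp] at key
    have := mul_le_mul_of_nonneg_left key hN0
    calc |a - b| ^ p = N * (N⁻¹ * |a - b| ^ p) := by field_simp
      _ ≤ _ := this
      _ = _ := by field_simp

/-- The odd power `t ↦ |t|^(p-2) t`. -/
def oddPow (p t : ℝ) : ℝ := |t| ^ (p - 2) * t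

lemma oddPow_neg (p t : ℝ) : oddPow p (-t) = -oddPow p t := by simp [oddPow]

lemma oddPow_of_nonneg {p t : ℝ} (hp : 1 < p) (ht : 0 ≤ t) : oddPow p t = t ^ (p - 1) := by
  rcases ht.eq_or_lt with rfl | ht
  · simp [oddPow, Real.zero_rpow (by linarith : p - 1 ≠ 0)]
  · rw [oddPow, abs_of_pos ht]
    nth_rewrite 2 [← Real.rpow_one t]
    rw [← Real.rpow_add ht]
    congr 1
    ring

lemma abs_oddPow {p : ℝ} (hp : 1 < p) (t : ℝ) : |oddPow p t| = |t| ^ (p - 1) := by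
  rw [← oddPow_of_nonneg hp (abs_nonneg t), oddPow, oddPow, abs_mul, abs_abs,
    abs_of_nonneg (Real.rpow_nonneg (abs_nonneg t) _)]

lemma strictMono_oddPow {p : ℝ} (hp : 1 < p) : StrictMono (oddPow p) := by
  refine strictMono_of_odd_strictMonoOn_nonneg (oddPow_neg p) fun s hs t ht hst => ?_
  rw [oddPow_of_nonneg hp hs, oddPow_of_nonneg hp ht]
  exact Real.rpow_lt_rpow hs hst (by linarith)

lemma oddPow_sub_mul_nonneg {p : ℝ} (hp : 1 < p) (s t : ℝ) :
    0 ≤ (oddPow p s - oddPow p t) * (s - t) := by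
  rcases le_total s t with h | h
  · exact mul_nonneg_of_nonpos_of_nonpos (sub_nonpos.2 ((strictMono_oddPow hp).monotone h))
      (sub_nonpos.2 h)
  · exact mul_nonneg (sub_nonneg.2 ((strictMono_oddPow hp).monotone h)) (sub_nonneg.2 h)

lemma rpow_eq_rpow_sub_one_mul {p t : ℝ} (hp : 1 < p) (ht : 0 ≤ t) : t ^ p = t ^ (p - 1) * t := by
  rcases ht.eq_or_lt with rfl | ht
  · simp [Real.zero_rpow (by linarith : p ≠ 0)]
  · nth_rewrite 3 [← Real.rpow_one t]
    rw [← Real.rpow_add ht]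
    congr 1
    ring

/-- Young's inequality without sharp constants: either w is replaced by κr or r by w/κ, whichever is
larger. -/
lemma rpow_sub_one_mul_le {p κ r w : ℝ} (hp : 1 < p) (hκ : 0 < κ) (hr : 0 ≤ r) (hw : 0 ≤ w) :
    r ^ (p - 1) * w ≤ κ * r ^ p + (κ⁻¹) ^ (p - 1) * w ^ p := by
  rcases le_total w (κ * r) with h | h
  · have h1 : r ^ (p - 1) * w ≤ r ^ (p - 1) * (κ * r) :=
      mul_le_mul_of_nonneg_left h (Real.rpow_nonneg hr _)
    have h2 : 0 ≤ (κ⁻¹) ^ (p - 1) * w ^ p := by positivity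
    rw [rpow_eq_rpow_sub_one_mul hp hr]
    linarith
  · have h1 : r ^ (p - 1) ≤ (κ⁻¹ * w) ^ (p - 1) := by
      refine Real.rpow_le_rpow hr ?_ (by linarith)
      rw [inv_mul_eq_div, le_div_iff₀ hκ]
      linarith
    rw [Real.mul_rpow (by positivity) hw] at h1
    have h2 := mul_le_mul_of_nonneg_right h1 hw
    rw [mul_assoc, ← rpow_eq_rpow_sub_one_mul hp hw] at h2
    have h3 : 0 ≤ κ * r ^ p := by positivity
    linarith

/-- If |s| > 2|t|, then |s - t| and the difference of the odd powers are comparable to |s| and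
|s|^(p-1); otherwise |t|^p suffices. In the application s is a gradient of possibly infinite energy
and t one of finite energy. -/
lemma exists_max_rpow_le {p : ℝ} (hp : 1 < p) :
    ∃ K : ℝ, 0 < K ∧ ∀ s t : ℝ,
      max |s| |t| ^ p ≤ K * ((oddPow p s - oddPow p t) * (s - t) + |t| ^ p) := by
  have hp0 : 0 < p := by linarith
  set q : ℝ := (1 / 2) ^ (p - 1) with hq
  have hq1 : q < 1 := Real.rpow_lt_one (by norm_num) (by norm_num) (by linarith)
  have h1q : 0 < 1 - q := by linarith
  have h2p : (1 : ℝ) ≤ 2 ^ p := Real.one_le_rpow (by norm_num) hp0.le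
  refine ⟨2 ^ p + 2 / (1 - q), by positivity, fun s t => ?_⟩
  have hT := oddPow_sub_mul_nonneg hp s t
  have ht := Real.rpow_nonneg (abs_nonneg t) p
  rcases le_or_gt |s| (2 * |t|) with h | h
  · have h1 : max |s| |t| ^ p ≤ 2 ^ p * |t| ^ p := by
      rw [← Real.mul_rpow (by norm_num) (abs_nonneg t)]
      exact Real.rpow_le_rpow (by positivity) (max_le h (by linarith [abs_nonneg t])) hp0.le
    have h3 : 0 ≤ 2 / (1 - q) * ((oddPow p s - oddPow p t) * (s - t) + |t| ^ p) := by positivity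
    nlinarith
  · rw [max_eq_left (by linarith [abs_nonneg t])]
    have h1 : |s| / 2 ≤ |s - t| := by linarith [abs_sub_abs_le_abs_sub s t]
    have h2 : (1 - q) * |s| ^ (p - 1) ≤ |oddPow p s - oddPow p t| := by
      have e1 := abs_sub_abs_le_abs_sub (oddPow p s) (oddPow p t)
      rw [abs_oddPow hp, abs_oddPow hp] at e1
      have e2 : |t| ^ (p - 1) ≤ (1 / 2 * |s|) ^ (p - 1) :=
        Real.rpow_le_rpow (abs_nonneg _) (by linarith) (by linarith)
      rw [Real.mul_rpow (by norm_num) (abs_nonneg _), ← hq] at e2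
      linarith
    have h3 := mul_le_mul h2 h1 (by positivity) (abs_nonneg _)
    rw [← abs_mul, abs_of_nonneg hT] at h3
    have h4 : |s| ^ p ≤ 2 / (1 - q) * ((oddPow p s - oddPow p t) * (s - t)) := by
      rw [div_mul_eq_mul_div, le_div_iff₀ h1q, rpow_eq_rpow_sub_one_mul hp (abs_nonneg s)]
      linarith
    have h5 : 0 ≤ 2 ^ p * ((oddPow p s - oddPow p t) * (s - t) + |t| ^ p) := by positivity
    have h6 : 0 ≤ 2 / (1 - q) * |t| ^ p := by positivity
    linarith

/-- The error term of the Caccioppoli estimate is absorbed by the main term. -/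
lemma exists_abs_oddPow_sub_mul_le {p : ℝ} (hp : 1 < p) {θ : ℝ} (hθ : 0 < θ) :
    ∃ C : ℝ, 0 ≤ C ∧ ∀ s t β w : ℝ, 0 ≤ β → 0 ≤ w →
      |oddPow p s - oddPow p t| * (β ^ (p - 1) * w) ≤
        θ * (β ^ p * ((oddPow p s - oddPow p t) * (s - t) + |t| ^ p)) + C * w ^ p := by
  obtain ⟨K, hK, h⟩ := exists_max_rpow_le hp
  -- Chosen so that the factor 2 from `h1`, Young's κ and the constant K multiply to θ.
  set κ := θ / (2 * K) with hκdef
  have hκ : 0 < κ := by positivity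
  refine ⟨2 * (κ⁻¹) ^ (p - 1), by positivity, fun s t β w hβ hw => ?_⟩
  set R := max |s| |t| with hR
  have hR0 : 0 ≤ R := by positivity
  have h1 : |oddPow p s - oddPow p t| ≤ 2 * R ^ (p - 1) := by
    have e1 := abs_sub (oddPow p s) (oddPow p t)
    rw [abs_oddPow hp, abs_oddPow hp] at e1
    have e2 : |s| ^ (p - 1) ≤ R ^ (p - 1) :=
      Real.rpow_le_rpow (abs_nonneg _) (le_max_left _ _) (by linarith)
    have e3 : |t| ^ (p - 1) ≤ R ^ (p - 1) :=
      Real.rpow_le_rpow (abs_nonneg _) (le_max_right _ _) (by linarith)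
    linarith
  have h2 := rpow_sub_one_mul_le hp hκ (mul_nonneg hβ hR0) hw
  rw [Real.mul_rpow hβ hR0, Real.mul_rpow hβ hR0] at h2
  have h3 := mul_le_mul_of_nonneg_left (h s t) (Real.rpow_nonneg hβ p)
  have h4 : |oddPow p s - oddPow p t| * (β ^ (p - 1) * w) ≤
      2 * R ^ (p - 1) * (β ^ (p - 1) * w) := mul_le_mul_of_nonneg_right h1 (by positivity)
  have h5 := mul_le_mul_of_nonneg_left h3 (by positivity : 0 ≤ 2 * κ)
  have h6 : 2 * κ * K = θ := by rw [hκdef]; field_simp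
  calc _ ≤ _ := h4
    _ = 2 * (β ^ (p - 1) * R ^ (p - 1) * w) := by ring
    _ ≤ 2 * (κ * (β ^ p * R ^ p) + (κ⁻¹) ^ (p - 1) * w ^ p) := by linarith
    _ = 2 * κ * (β ^ p * R ^ p) + 2 * (κ⁻¹) ^ (p - 1) * w ^ p := by ring
    _ ≤ 2 * κ * (β ^ p * (K * ((oddPow p s - oddPow p t) * (s - t) + |t| ^ p)))
        + 2 * (κ⁻¹) ^ (p - 1) * w ^ p := by linarith
    _ = _ := by rw [← h6]; ring

/-- Bernoulli's inequality at α/β, multiplied by β^p. -/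
lemma rpow_sub_rpow_le {p α β : ℝ} (hp : 1 < p) (hα : 0 ≤ α) (hαβ : α ≤ β) :
    β ^ p - α ^ p ≤ p * β ^ (p - 1) * (β - α) := by
  rcases (hα.trans hαβ).eq_or_lt with h0 | hβ
  · have : α = 0 := by linarith
    simp [← h0, this]
  · have h1 := one_add_mul_self_le_rpow_one_add (s := α / β - 1) (by
      have := div_nonneg hα hβ.le
      linarith) hp.le
    rw [show 1 + (α / β - 1) = α / β by ring, Real.div_rpow hα hβ.le] at h1
    have hβp := Real.rpow_pos_of_pos hβ p
    rw [le_div_iff₀ hβp] at h1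
    have e := rpow_eq_rpow_sub_one_mul hp hβ.le
    have h2 : (1 + p * (α / β - 1)) * β ^ p = β ^ p - p * β ^ (p - 1) * (β - α) := by
      rw [e]; field_simp; ring
    linarith

lemma abs_rpow_sub_rpow_le {p α β : ℝ} (hp : 1 < p) (hα : 0 ≤ α) (hβ : 0 ≤ β) :
    |β ^ p - α ^ p| ≤ p * (max α β ^ (p - 1) * |β - α|) := by
  rcases le_total α β with h | h
  · rw [abs_of_nonneg (sub_nonneg.2 (Real.rpow_le_rpow hα h (by linarith))),
      abs_of_nonneg (sub_nonneg.2 h), max_eq_right h]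
    linarith [rpow_sub_rpow_le hp hα h]
  · rw [abs_sub_comm, abs_sub_comm β,
      abs_of_nonneg (sub_nonneg.2 (Real.rpow_le_rpow hβ h (by linarith))),
      abs_of_nonneg (sub_nonneg.2 h), max_eq_left h]
    linarith [rpow_sub_rpow_le hp hβ h]

end Scalar

/-! ### The Dirichlet sum: quasi-triangle inequalities, Fatou's lemma, uniform convexity. -/

section Energy

variable {V : Type*} (G : SimpleGraph V) [G.LocallyFinite] {p : ℝ}

lemma dirichletSum_nonneg (f : V → ℝ) : 0 ≤ dirichletSum G p f :=
  tsum_nonneg fun x => gradPow_nonneg G p f x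

lemma sum_gradPow_le_dirichletSum {f : V → ℝ} (hf : DirichletFinite G p f) (S : Finset V) :
    ∑ x ∈ S, gradPow G p f x ≤ dirichletSum G p f :=
  hf.sum_le_tsum S fun x _ => gradPow_nonneg G p f x

lemma abs_sub_rpow_le_dirichletSum {f : V → ℝ} (hf : DirichletFinite G p f) {x y : V}
    (hxy : G.Adj x y) : |f y - f x| ^ p ≤ dirichletSum G p f := by
  have h1 : |f y - f x| ^ p ≤ gradPow G p f x :=
    Finset.single_le_sum (f := fun y => |f y - f x| ^ p)
      (fun z _ => Real.rpow_nonneg (abs_nonneg _) _) ((G.mem_neighborFinset x y).2 hxy)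
  have h2 := sum_gradPow_le_dirichletSum G hf {x}
  rw [Finset.sum_singleton] at h2
  exact h1.trans h2

lemma dirichletSum_le_of_le (hp : 0 < p) {f g k : V → ℝ} (hf : DirichletFinite G p f)
    (hg : DirichletFinite G p g) {A B : ℝ} (hA : 0 ≤ A) (hB : 0 ≤ B)
    (h : ∀ x y, |k y - k x| ≤ A * |f y - f x| + B * |g y - g x|) :
    dirichletSum G p k ≤ 2 ^ p * (A ^ p * dirichletSum G p f + B ^ p * dirichletSum G p g) := by
  have hs := ((hf.hasSum.mul_left (A ^ p)).add (hg.hasSum.mul_left (B ^ p))).mul_left (2 ^ p)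
  exact hasSum_le (gradPow_le G hp hA hB h)
    (DirichletFinite.of_le G hp hf hg hA hB h).hasSum hs

lemma gradPow_le_of_abs_sub_le (hp : 0 < p) {f k : V → ℝ}
    (h : ∀ x y, |k y - k x| ≤ |f y - f x|) (x : V) : gradPow G p k x ≤ gradPow G p f x :=
  Finset.sum_le_sum fun y _ => Real.rpow_le_rpow (abs_nonneg _) (h x y) hp.le

lemma DirichletFinite.of_abs_sub_le (hp : 0 < p) {f k : V → ℝ} (hf : DirichletFinite G p f)
    (h : ∀ x y, |k y - k x| ≤ |f y - f x|) : DirichletFinite G p k :=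
  Summable.of_nonneg_of_le (gradPow_nonneg G p k) (gradPow_le_of_abs_sub_le G hp h) hf

lemma dirichletSum_le_of_abs_sub_le (hp : 0 < p) {f k : V → ℝ} (hf : DirichletFinite G p f)
    (h : ∀ x y, |k y - k x| ≤ |f y - f x|) : dirichletSum G p k ≤ dirichletSum G p f :=
  hasSum_le (gradPow_le_of_abs_sub_le G hp h)
    (DirichletFinite.of_abs_sub_le G hp hf h).hasSum hf.hasSum

lemma DirichletFinite.of_finite_support (hp : 0 < p) {f : V → ℝ}
    (hf : (Function.support f).Finite) : DirichletFinite G p f := by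
  classical
  refine summable_of_ne_finset_zero
    (s := hf.toFinset ∪ hf.toFinset.biUnion fun x => G.neighborFinset x) fun x hx => ?_
  simp only [Finset.mem_union, Finset.mem_biUnion, Set.Finite.mem_toFinset, Function.mem_support,
    SimpleGraph.mem_neighborFinset, not_or, not_exists, not_and, not_not] at hx
  refine Finset.sum_eq_zero fun y hy => ?_
  have hy0 : f y = 0 := by
    by_contra h
    exact hx.2 y h ((G.mem_neighborFinset x y).1 hy).symm
  simp [hx.1, hy0, Real.zero_rpow hp.ne']

lemma DirichletFinite.add (hp : 0 < p) {f g : V → ℝ} (hf : DirichletFinite G p f)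
    (hg : DirichletFinite G p g) : DirichletFinite G p (f + g) :=
  DirichletFinite.of_le G hp hf hg zero_le_one zero_le_one fun x y => by
    rw [Pi.add_apply, Pi.add_apply, one_mul, one_mul,
      show f y + g y - (f x + g x) = (f y - f x) + (g y - g x) by ring]
    exact abs_add_le _ _

lemma dirichletSum_add_le (hp : 0 < p) {f g : V → ℝ} (hf : DirichletFinite G p f)
    (hg : DirichletFinite G p g) :
    dirichletSum G p (f + g) ≤ 2 ^ p * (dirichletSum G p f + dirichletSum G p g) := by
  have := dirichletSum_le_of_le G hp (k := f + g) hf hg zero_le_one zero_le_one fun x y => by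
    rw [Pi.add_apply, Pi.add_apply, one_mul, one_mul,
      show f y + g y - (f x + g x) = (f y - f x) + (g y - g x) by ring]
    exact abs_add_le _ _
  simpa using this

lemma gradPow_neg (f : V → ℝ) : gradPow G p (-f) = gradPow G p f := by
  funext x
  refine Finset.sum_congr rfl fun y _ => ?_
  rw [Pi.neg_apply, Pi.neg_apply, neg_sub_neg, abs_sub_comm]

lemma DirichletFinite.neg {f : V → ℝ} (hf : DirichletFinite G p f) : DirichletFinite G p (-f) := by
  rwa [DirichletFinite, gradPow_neg]

lemma dirichletSum_neg (f : V → ℝ) : dirichletSum G p (-f) = dirichletSum G p f := by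
  rw [dirichletSum, gradPow_neg, dirichletSum]

lemma DirichletFinite.sub (hp : 0 < p) {f g : V → ℝ} (hf : DirichletFinite G p f)
    (hg : DirichletFinite G p g) : DirichletFinite G p (f - g) := by
  rw [sub_eq_add_neg]
  exact hf.add G hp (hg.neg G)

lemma dirichletSum_sub_le (hp : 0 < p) {f g : V → ℝ} (hf : DirichletFinite G p f)
    (hg : DirichletFinite G p g) :
    dirichletSum G p (f - g) ≤ 2 ^ p * (dirichletSum G p f + dirichletSum G p g) := by
  rw [sub_eq_add_neg, ← dirichletSum_neg G g]
  exact dirichletSum_add_le G hp hf (hg.neg G)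

/-- Fatou's lemma for the Dirichlet sum. -/
lemma dirichletFinite_and_dirichletSum_le_of_tendsto {ι : Type*} {l : Filter ι} [l.NeBot]
    (hp : 0 < p) {u : ι → V → ℝ} {g : V → ℝ} {B : ℝ}
    (hu : ∀ᶠ i in l, DirichletFinite G p (u i) ∧ dirichletSum G p (u i) ≤ B)
    (hg : ∀ x, Tendsto (fun i => u i x) l (𝓝 (g x))) :
    DirichletFinite G p g ∧ dirichletSum G p g ≤ B := by
  have hS : ∀ S : Finset V, ∑ x ∈ S, gradPow G p g x ≤ B := fun S => by
    have ht : Tendsto (fun i => ∑ x ∈ S, gradPow G p (u i) x) l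
        (𝓝 (∑ x ∈ S, gradPow G p g x)) :=
      tendsto_finsetSum _ fun x _ => tendsto_finsetSum _ fun y _ =>
        ((continuous_abs_rpow hp).tendsto _).comp ((hg y).sub (hg x))
    refine le_of_tendsto ht (hu.mono fun i hi => ?_)
    exact (sum_gradPow_le_dirichletSum G hi.1 S).trans hi.2
  have hs : DirichletFinite G p g := summable_of_sum_le (gradPow_nonneg G p g) hS
  exact ⟨hs, hs.tsum_le_of_sum_le hS⟩

lemma dpNorm_lt_iff (hp : 0 < p) (o : V) (f : V → ℝ) {ε : ℝ} (hε : 0 < ε) :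
    dpNorm G p o f < ε ↔ dirichletSum G p f + |f o| ^ p < ε ^ p := by
  rw [dpNorm, one_div, Real.rpow_inv_lt_iff_of_pos
    (add_nonneg (dirichletSum_nonneg G f) (Real.rpow_nonneg (abs_nonneg _) _)) hε.le hp]

/-- Uniform convexity of the Dirichlet sum. -/
lemma exists_dirichletSum_sub_le (hp : 1 < p) {ε : ℝ} (hε : 0 < ε) :
    ∃ C : ℝ, 0 ≤ C ∧ ∀ f g : V → ℝ, DirichletFinite G p f → DirichletFinite G p g →
      dirichletSum G p (f - g) ≤ ε * (dirichletSum G p f + dirichletSum G p g) +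
        C * ((dirichletSum G p f + dirichletSum G p g) / 2 -
          dirichletSum G p fun x => (f x + g x) / 2) := by
  obtain ⟨C, hC, h⟩ := exists_abs_sub_rpow_le hp hε
  have hp0 : 0 < p := by linarith
  refine ⟨C, hC, fun f g hf hg => ?_⟩
  have hmid : DirichletFinite G p fun x => (f x + g x) / 2 := by
    refine DirichletFinite.of_abs_sub_le G hp0 (hf.add G hp0 hg) fun x y => ?_
    rw [← sub_div, abs_div, abs_two]
    exact div_le_self (abs_nonneg _) (by norm_num)
  refine hasSum_le (fun x => ?_) (hf.sub G hp0 hg).hasSum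
    (((hf.hasSum.add hg.hasSum).mul_left ε).add
      ((((hf.hasSum.add hg.hasSum).div_const 2).sub hmid.hasSum).mul_left C))
  simp only [gradPow]
  rw [← Finset.sum_add_distrib, Finset.mul_sum, Finset.sum_div, ← Finset.sum_sub_distrib,
    Finset.mul_sum, ← Finset.sum_add_distrib]
  refine Finset.sum_le_sum fun y _ => ?_
  have := h (f y - f x) (g y - g x)
  rw [midDefect] at this
  rw [Pi.sub_apply, Pi.sub_apply, show f y - g y - (f x - g x) = f y - f x - (g y - g x) by ring,
    show (f y + g y) / 2 - (f x + g x) / 2 = (f y - f x + (g y - g x)) / 2 by ring]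
  exact this

end Energy

/-! ### The closure of the finitely supported functions: weak closedness and ideal property. -/

section Closure

variable {V : Type*} (G : SimpleGraph V) [G.LocallyFinite] {p : ℝ} (o : V)

lemma mem_finSuppClosure_of_finite_support (hp : 0 < p) {f : V → ℝ}
    (hf : (Function.support f).Finite) : f ∈ finSuppClosure G p o := by
  refine ⟨DirichletFinite.of_finite_support G hp hf, fun ε hε => ⟨f, hf, ?_⟩⟩
  rw [sub_self, dpNorm_lt_iff G hp o _ hε]
  have : dirichletSum G p (0 : V → ℝ) = 0 := by
    simp [dirichletSum, gradPow, Real.zero_rpow hp.ne']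
  simpa [this, Real.zero_rpow hp.ne'] using Real.rpow_pos_of_pos hε p

/-- Weak closedness: a function that is approximated on finite sets by finitely supported functions
of bounded energy lies in the closure of the finitely supported functions. -/
lemma mem_finSuppClosure_of_approx (hp : 1 < p) {g : V → ℝ} {B : ℝ}
    (h : ∀ (S : Finset V) (δ : ℝ), 0 < δ → ∃ η : V → ℝ, (Function.support η).Finite ∧
      dirichletSum G p η ≤ B ∧ ∀ x ∈ S, |η x - g x| ≤ δ) : g ∈ finSuppClosure G p o := by
  classical
  have hp0 : 0 < p := by linarith
  have hB : 0 ≤ B := by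
    obtain ⟨η, -, h1, -⟩ := h ∅ 1 one_pos
    exact (dirichletSum_nonneg G η).trans h1
  let δ : Finset V × ℕ → ℝ := fun a => 1 / ((a.2 : ℝ) + 1)
  have hδ0 : ∀ a, 0 < δ a := fun a => Nat.one_div_pos_of_nat
  have hδ1 : ∀ a, δ a ≤ 1 := fun a => by
    have : (0 : ℝ) ≤ a.2 := Nat.cast_nonneg _
    simp only [δ]
    rw [div_le_one (by linarith)]
    linarith
  have hδanti : ∀ a b, a ≤ b → δ b ≤ δ a := fun a b hab =>
    Nat.one_div_le_one_div hab.2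
  have hδt : Tendsto δ atTop (𝓝 0) := by
    rw [← prod_atTop_atTop_eq]
    exact tendsto_one_div_add_atTop_nhds_zero_nat.comp tendsto_snd
  -- The sets `A a` shrink as `a` grows, so their energy infima `m a` increase, and they stay below
  -- B. Near-minimisers `η a` will be Cauchy in energy by uniform convexity.
  let A : Finset V × ℕ → Set (V → ℝ) := fun a =>
    {η | (Function.support η).Finite ∧ ∀ x ∈ a.1, |η x - g x| ≤ δ a}
  let m : Finset V × ℕ → ℝ := fun a => sInf (dirichletSum G p '' A a)
  have hAanti : ∀ a b, a ≤ b → A b ⊆ A a := fun a b hab η hη =>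
    ⟨hη.1, fun x hx => (hη.2 x (hab.1 hx)).trans (hδanti a b hab)⟩
  have hbdd : ∀ a, BddBelow (dirichletSum G p '' A a) := fun a =>
    ⟨0, by rintro _ ⟨η, -, rfl⟩; exact dirichletSum_nonneg G η⟩
  have hne : ∀ a, (dirichletSum G p '' A a).Nonempty := fun a => by
    obtain ⟨η, h1, -, h3⟩ := h a.1 (δ a) (hδ0 a)
    exact ⟨_, η, ⟨h1, h3⟩, rfl⟩
  have hmmono : Monotone m := fun a b hab =>
    csInf_le_csInf (hbdd a) (hne b) (Set.image_mono (hAanti a b hab))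
  have hmB : ∀ a, m a ≤ B := fun a => by
    obtain ⟨η, h1, h2, h3⟩ := h a.1 (δ a) (hδ0 a)
    exact (csInf_le (hbdd a) ⟨η, ⟨h1, h3⟩, rfl⟩).trans h2
  have hmbdd : BddAbove (Set.range m) := ⟨B, by rintro _ ⟨a, rfl⟩; exact hmB a⟩
  have hmt := tendsto_atTop_ciSup hmmono hmbdd
  have hmL : ∀ a, m a ≤ ⨆ a, m a := fun a => le_ciSup hmbdd a
  have hchoose : ∀ a, ∃ η ∈ A a, dirichletSum G p η < m a + δ a := fun a => by
    obtain ⟨_, ⟨η, hη, rfl⟩, hlt⟩ := exists_lt_of_csInf_lt (hne a) (lt_add_of_pos_right (m a) (hδ0 a))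
    exact ⟨η, hη, hlt⟩
  choose η hηA hηI using hchoose
  have hηD : ∀ a, DirichletFinite G p (η a) := fun a =>
    DirichletFinite.of_finite_support G hp0 (hηA a).1
  have hηt : ∀ x, Tendsto (fun a => η a x) atTop (𝓝 (g x)) := fun x => by
    rw [tendsto_iff_norm_sub_tendsto_zero]
    refine squeeze_zero' (Eventually.of_forall fun a => norm_nonneg _) ?_ hδt
    filter_upwards [eventually_ge_atTop (({x}, 0) : Finset V × ℕ)] with a ha
    exact (hηA a).2 x (ha.1 (Finset.mem_singleton_self x))
  have hclose : ∀ κ : ℝ, 0 < κ → ∀ᶠ a in atTop,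
      DirichletFinite G p (η a - g) ∧ dirichletSum G p (η a - g) ≤ κ := fun κ hκ => by
    obtain ⟨C, hC, hconv⟩ := exists_dirichletSum_sub_le G hp
      (show 0 < κ / (4 * (B + 1)) by positivity)
    have ht : Tendsto (fun a => C * (((⨆ a, m a) - m a) / 2 + δ a)) atTop (𝓝 0) := by
      have := (((hmt.const_sub (⨆ a, m a)).div_const 2).add hδt).const_mul C
      simpa using this
    filter_upwards [ht.eventually_lt_const (show 0 < κ / 2 by positivity)] with a ha
    -- Fatou in b, with a fixed, turns the Cauchy estimate into one against g, whose energy is not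
    -- yet known to be finite.
    refine dirichletFinite_and_dirichletSum_le_of_tendsto G hp0 (l := atTop)
      (u := fun b => η a - η b) ?_ fun x => (hηt x).const_sub (η a x)
    filter_upwards [eventually_ge_atTop a] with b hab
    refine ⟨(hηD a).sub G hp0 (hηD b), (hconv _ _ (hηD a) (hηD b)).trans ?_⟩
    -- For a ≤ b both functions lie in the convex set `A a`, hence so does their midpoint.
    have hmid : m a ≤ dirichletSum G p fun x => (η a x + η b x) / 2 := by
      refine csInf_le (hbdd a) ⟨_, ⟨?_, fun x hx => ?_⟩, rfl⟩
      · refine ((hηA a).1.union (hηA b).1).subset fun x hx => ?_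
        by_contra hc
        simp only [Set.mem_union, Function.mem_support, not_or, not_not] at hc
        simp [hc.1, hc.2] at hx
      · have h1 := abs_le.1 ((hηA a).2 x hx)
        have h2 := abs_le.1 ((hAanti a b hab (hηA b)).2 x hx)
        rw [abs_le]
        constructor <;> linarith [h1.1, h1.2, h2.1, h2.2]
    have e1 := hηI a
    have e2 := hηI b
    have h1 : κ / (4 * (B + 1)) * (dirichletSum G p (η a) + dirichletSum G p (η b)) ≤ κ / 2 := by
      have : dirichletSum G p (η a) + dirichletSum G p (η b) ≤ 2 * (B + 1) := by
        linarith [hmB a, hmB b, hδ1 a, hδ1 b]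
      refine (mul_le_mul_of_nonneg_left this (by positivity)).trans (le_of_eq ?_)
      field_simp
      norm_num
    have h2 := mul_le_mul_of_nonneg_left (show (dirichletSum G p (η a) + dirichletSum G p (η b)) / 2 -
        dirichletSum G p (fun x => (η a x + η b x) / 2) ≤ ((⨆ a, m a) - m a) / 2 + δ a by
      linarith [hmL b, hδanti a b hab]) hC
    linarith
  obtain ⟨a, ha, -⟩ := (hclose 1 one_pos).exists
  refine ⟨?_, fun ε hε => ?_⟩
  · have := (hηD a).sub G hp0 ha
    rwa [sub_sub_cancel] at this
  · have hεp : 0 < ε ^ p := Real.rpow_pos_of_pos hε p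
    have ho : Tendsto (fun a => |η a o - g o| ^ p) atTop (𝓝 0) := by
      have := ((continuous_abs_rpow hp0).tendsto _).comp ((hηt o).sub_const (g o))
      simpa [Function.comp_def, Real.zero_rpow hp0.ne'] using this
    obtain ⟨a, ha1, ha2⟩ := ((hclose (ε ^ p / 2) (by positivity)).and
      (ho.eventually_lt_const (show 0 < ε ^ p / 2 by positivity))).exists
    refine ⟨η a, (hηA a).1, ?_⟩
    rw [dpNorm_lt_iff G hp0 o _ hε, ← neg_sub, dirichletSum_neg, Pi.neg_apply, abs_neg,
      Pi.sub_apply]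
    linarith [ha1.2]

/-- Together with `exists_bounded_energy_seq` this describes the closure by pointwise limits of
bounded energy, so that its algebraic properties need energy bounds only and no norm convergence. -/
lemma mem_finSuppClosure_of_tendsto (hp : 1 < p) {g : V → ℝ} {B : ℝ} {η : ℕ → V → ℝ}
    (hfin : ∀ k, (Function.support (η k)).Finite) (hB : ∀ᶠ k in atTop, dirichletSum G p (η k) ≤ B)
    (hg : ∀ x, Tendsto (fun k => η k x) atTop (𝓝 (g x))) : g ∈ finSuppClosure G p o := by
  refine mem_finSuppClosure_of_approx G o hp (B := B) fun S δ hδ => ?_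
  have : ∀ᶠ k in atTop, ∀ x ∈ S, |η k x - g x| ≤ δ := by
    rw [Finset.eventually_all]
    intro x _
    have := (tendsto_iff_norm_sub_tendsto_zero.1 (hg x)).eventually_lt_const hδ
    exact this.mono fun k hk => hk.le
  obtain ⟨k, h1, h2⟩ := (hB.and this).exists
  exact ⟨η k, hfin k, h1, h2⟩

/-- Elements of the closure are limits, in energy and pointwise, of finitely supported functions. -/
lemma exists_seq_of_mem_finSuppClosure (hconn : G.Connected) (hp : 1 < p) {g : V → ℝ}
    (hg : g ∈ finSuppClosure G p o) : ∃ η : ℕ → V → ℝ, (∀ k, (Function.support (η k)).Finite) ∧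
      Tendsto (fun k => dirichletSum G p (η k - g)) atTop (𝓝 0) ∧
      ∀ x, Tendsto (fun k => η k x) atTop (𝓝 (g x)) := by
  have hp0 : 0 < p := by linarith
  choose η hfin hη using fun k : ℕ => hg.2 (1 / ((k : ℝ) + 1)) Nat.one_div_pos_of_nat
  have hD : ∀ k, DirichletFinite G p (η k - g) := fun k =>
    (DirichletFinite.of_finite_support G hp0 (hfin k)).sub G hp0 hg.1
  have hlt : ∀ k, dirichletSum G p (η k - g) + |η k o - g o| ^ p < (1 / ((k : ℝ) + 1)) ^ p :=
    fun k => by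
    have := (dpNorm_lt_iff G hp0 o _ Nat.one_div_pos_of_nat).1 (hη k)
    rwa [← neg_sub, dirichletSum_neg, Pi.neg_apply, abs_neg] at this
  have ht : Tendsto (fun k : ℕ => (1 / ((k : ℝ) + 1)) ^ p) atTop (𝓝 0) := by
    have := (tendsto_one_div_add_atTop_nhds_zero_nat (𝕜 := ℝ)).rpow_const (p := p)
      (Or.inr hp0.le)
    simpa [Real.zero_rpow hp0.ne'] using this
  have hI : Tendsto (fun k => dirichletSum G p (η k - g)) atTop (𝓝 0) :=
    squeeze_zero (fun k => dirichletSum_nonneg G _) (fun k => by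
      have := Real.rpow_nonneg (abs_nonneg (η k o - g o)) p
      linarith [hlt k]) ht
  have root : ∀ {u : ℕ → ℝ}, Tendsto (fun k => |u k| ^ p) atTop (𝓝 0) →
      Tendsto u atTop (𝓝 0) := fun {u} hu => by
    have h1 := hu.rpow_const (p := p⁻¹) (Or.inr (by positivity))
    simp only [Real.rpow_rpow_inv (abs_nonneg _) hp0.ne'] at h1
    rw [Real.zero_rpow (by positivity)] at h1
    exact (tendsto_zero_iff_abs_tendsto_zero _).2 h1
  have h0 : Tendsto (fun k => η k o - g o) atTop (𝓝 0) :=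
    root (squeeze_zero (fun k => Real.rpow_nonneg (abs_nonneg _) _) (fun k => by
      linarith [hlt k, dirichletSum_nonneg G (p := p) (η k - g)]) ht)
  -- The norm controls the value at `o` and all differences along edges; connectedness then
  -- propagates convergence from `o` to every vertex.
  have hstep : ∀ x y, G.Adj x y → Tendsto (fun k => η k x - g x) atTop (𝓝 0) →
      Tendsto (fun k => η k y - g y) atTop (𝓝 0) := fun x y hxy hx => by
    have h1 : Tendsto (fun k => (η k - g) y - (η k - g) x) atTop (𝓝 0) :=
      root (squeeze_zero (fun k => Real.rpow_nonneg (abs_nonneg _) _)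
        (fun k => abs_sub_rpow_le_dirichletSum G (hD k) hxy) hI)
    simpa using h1.add hx
  refine ⟨η, hfin, hI, fun x => ?_⟩
  have : Tendsto (fun k => η k x - g x) atTop (𝓝 0) := by
    have hwalk : ∀ {u v : V}, G.Walk u v → Tendsto (fun k => η k u - g u) atTop (𝓝 0) →
        Tendsto (fun k => η k v - g v) atTop (𝓝 0) := fun w => by
      induction w with
      | nil => exact id
      | cons h _ ih => exact fun hu => ih (hstep _ _ h hu)
    obtain ⟨w⟩ := hconn.preconnected o x
    exact hwalk w h0
  simpa using this.add_const (g x)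

lemma exists_bounded_energy_seq (hconn : G.Connected) (hp : 1 < p) {g : V → ℝ}
    (hg : g ∈ finSuppClosure G p o) : ∃ (η : ℕ → V → ℝ) (B : ℝ),
      (∀ k, (Function.support (η k)).Finite) ∧ (∀ᶠ k in atTop, dirichletSum G p (η k) ≤ B) ∧
      ∀ x, Tendsto (fun k => η k x) atTop (𝓝 (g x)) := by
  have hp0 : 0 < p := by linarith
  obtain ⟨η, h1, h2, h3⟩ := exists_seq_of_mem_finSuppClosure G o hconn hp hg
  refine ⟨η, 2 ^ p * (1 + dirichletSum G p g), h1, ?_, h3⟩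
  filter_upwards [h2.eventually_lt_const one_pos] with k hk
  have := dirichletSum_add_le G hp0
    ((DirichletFinite.of_finite_support G hp0 (h1 k)).sub G hp0 hg.1) hg.1
  rw [sub_add_cancel] at this
  refine this.trans ?_
  gcongr

lemma add_mem_finSuppClosure (hconn : G.Connected) (hp : 1 < p) {f g : V → ℝ}
    (hf : f ∈ finSuppClosure G p o) (hg : g ∈ finSuppClosure G p o) :
    f + g ∈ finSuppClosure G p o := by
  have hp0 : 0 < p := by linarith
  obtain ⟨η, B, h1, h2, h3⟩ := exists_bounded_energy_seq G o hconn hp hf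
  obtain ⟨ξ, B', h1', h2', h3'⟩ := exists_bounded_energy_seq G o hconn hp hg
  refine mem_finSuppClosure_of_tendsto G o hp (η := fun k => η k + ξ k) (B := 2 ^ p * (B + B'))
    (fun k => ((h1 k).union (h1' k)).subset (Function.support_add _ _)) ?_
    fun x => (h3 x).add (h3' x)
  filter_upwards [h2, h2'] with k hk hk'
  refine (dirichletSum_add_le G hp0 (DirichletFinite.of_finite_support G hp0 (h1 k))
    (DirichletFinite.of_finite_support G hp0 (h1' k))).trans ?_
  gcongr

/-- Truncation of a real number to `[-M, M]`. -/
def clip (M t : ℝ) : ℝ := max (-M) (min M t)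

lemma abs_clip_le {M : ℝ} (hM : 0 ≤ M) (t : ℝ) : |clip M t| ≤ M := by
  rw [abs_le]
  exact ⟨le_max_left _ _, max_le (by linarith) (min_le_left _ _)⟩

lemma clip_of_abs_le {M t : ℝ} (h : |t| ≤ M) : clip M t = t := by
  rw [clip, min_eq_right (abs_le.1 h).2, max_eq_right (abs_le.1 h).1]

lemma abs_clip_sub_clip_le (M s t : ℝ) : |clip M s - clip M t| ≤ |s - t| := by
  refine (abs_max_sub_max_le_max _ _ _ _).trans (max_le (by simp) ?_)
  exact (abs_min_sub_min_le_max _ _ _ _).trans (max_le (by simp) le_rfl)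

lemma continuous_clip (M : ℝ) : Continuous (clip M) :=
  continuous_const.max (continuous_const.min continuous_id)

/-- Bounded elements of the closure form an ideal of `BD_p(G)`. -/
lemma mul_mem_finSuppClosure (hconn : G.Connected) (hp : 1 < p) {w g : V → ℝ}
    (hw : DirichletFinite G p w) (hwb : IsBdd w) (hg : g ∈ finSuppClosure G p o)
    (hgb : IsBdd g) : w * g ∈ finSuppClosure G p o := by
  have hp0 : 0 < p := by linarith
  obtain ⟨η, B, h1, h2, h3⟩ := exists_bounded_energy_seq G o hconn hp hg
  obtain ⟨M, hM⟩ := hgb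
  obtain ⟨N, hN⟩ := hwb
  have hM0 : 0 ≤ M := (abs_nonneg _).trans (hM o)
  have hN0 : 0 ≤ N := (abs_nonneg _).trans (hN o)
  have hclip : ∀ k, DirichletFinite G p fun x => clip M (η k x) := fun k =>
    DirichletFinite.of_abs_sub_le G hp0 (DirichletFinite.of_finite_support G hp0 (h1 k))
      fun x y => abs_clip_sub_clip_le M _ _
  -- The η k need not be uniformly bounded. Clipping at the bound M of g bounds the energy of the
  -- product and leaves the limit g unchanged.
  refine mem_finSuppClosure_of_tendsto G o hp (η := fun k x => w x * clip M (η k x))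
    (B := 2 ^ p * (N ^ p * B + M ^ p * dirichletSum G p w)) (fun k => ?_) ?_ fun x => ?_
  · refine (h1 k).subset fun x hx hx0 => hx ?_
    simp [hx0, clip_of_abs_le, hM0]
  · filter_upwards [h2] with k hk
    refine (dirichletSum_le_of_le G hp0 (hclip k) hw hN0 hM0 fun x y => ?_).trans ?_
    · have e : w y * clip M (η k y) - w x * clip M (η k x) =
        w y * (clip M (η k y) - clip M (η k x)) + clip M (η k x) * (w y - w x) := by ring
      rw [e]
      refine (abs_add_le _ _).trans ?_
      rw [abs_mul, abs_mul]
      have e1 := hN y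
      have e2 := abs_clip_le hM0 (η k x)
      gcongr
    · have : dirichletSum G p (fun x => clip M (η k x)) ≤ B :=
        (dirichletSum_le_of_abs_sub_le G hp0 (DirichletFinite.of_finite_support G hp0 (h1 k))
          fun x y => abs_clip_sub_clip_le M _ _).trans hk
      gcongr
  · have := ((continuous_clip M).tendsto (g x)).comp (h3 x)
    rw [clip_of_abs_le (hM x)] at this
    exact this.const_mul (w x)

end Closure

/-! ### Characters of the algebra, ultrafilter limits, and negligible sets at infinity. -/

section Characters

variable {V : Type*} (G : SimpleGraph V) [G.LocallyFinite] {p : ℝ} {hp : 1 < p}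

lemma comp_mem_BD {g : V → ℝ} (hg : g ∈ BD G p hp) {φ : ℝ → ℝ} {L C : ℝ} (hL : 0 ≤ L)
    (hφ : ∀ s t, |φ s - φ t| ≤ L * |s - t|) (hC : ∀ t, |φ t| ≤ C) :
    (fun x => φ (g x)) ∈ BD G p hp :=
  ⟨DirichletFinite.of_le G (by linarith) hg.1 hg.1 hL le_rfl fun x y => by
    rw [zero_mul, add_zero]; exact hφ _ _, C, fun x => hC _⟩

/-- Truncation below at c makes inversion Lipschitz. This supplies inverses in `BD` and, later, the
normalisation of a square to the value 1. -/
lemma inv_max_mem_BD {g : V → ℝ} (hg : g ∈ BD G p hp) {c : ℝ} (hc : 0 < c) :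
    (fun x => (max (g x) c)⁻¹) ∈ BD G p hp := by
  refine comp_mem_BD G hg (φ := fun t => (max t c)⁻¹) (L := (c * c)⁻¹) (C := c⁻¹) (by positivity)
    (fun s t => ?_) fun t => ?_
  · have hs : c ≤ max s c := le_max_right _ _
    have ht : c ≤ max t c := le_max_right _ _
    have hs0 : 0 < max s c := hc.trans_le hs
    have ht0 : 0 < max t c := hc.trans_le ht
    rw [inv_sub_inv hs0.ne' ht0.ne', abs_div, abs_of_pos (mul_pos hs0 ht0), div_eq_inv_mul]
    refine mul_le_mul (inv_anti₀ (by positivity) (mul_le_mul hs ht hc.le hs0.le)) ?_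
      (abs_nonneg _) (by positivity)
    rw [abs_sub_comm s t]
    exact (abs_max_sub_max_le_max _ _ _ _).trans (max_le le_rfl (by simp))
  · have ht : c ≤ max t c := le_max_right _ _
    rw [abs_of_pos (inv_pos.2 (hc.trans_le ht))]
    exact inv_anti₀ hc ht

@[simp] lemma gelfand_add (f g : BD G p hp) (τ : Sp G p hp) :
    gelfand G (f + g) τ = gelfand G f τ + gelfand G g τ := by
  unfold gelfand; exact map_add _ _ _

@[simp] lemma gelfand_sub (f g : BD G p hp) (τ : Sp G p hp) :
    gelfand G (f - g) τ = gelfand G f τ - gelfand G g τ := by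
  unfold gelfand; exact map_sub _ _ _

@[simp] lemma gelfand_mul (f g : BD G p hp) (τ : Sp G p hp) :
    gelfand G (f * g) τ = gelfand G f τ * gelfand G g τ := by
  unfold gelfand; exact map_mul _ _ _

@[simp] lemma gelfand_one (τ : Sp G p hp) : gelfand G (1 : BD G p hp) τ = 1 := by
  unfold gelfand; exact map_one _

@[simp] lemma gelfand_smul (r : ℝ) (f : BD G p hp) (τ : Sp G p hp) :
    gelfand G (r • f) τ = r * gelfand G f τ := by
  unfold gelfand
  rw [map_smul, Complex.real_smul]

@[simp] lemma gelfand_algebraMap (r : ℝ) (τ : Sp G p hp) :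
    gelfand G (algebraMap ℝ (BD G p hp) r) τ = r := by
  unfold gelfand
  rw [AlgHom.commutes]
  rfl

lemma gelfand_evalChar (f : BD G p hp) (x : V) :
    gelfand G f (evalChar G p hp x) = ((f : V → ℝ) x : ℂ) := rfl

lemma continuous_gelfand (f : BD G p hp) : Continuous (gelfand G f) :=
  (continuous_apply f).comp continuous_induced_dom

/-- Such a g is a unit of `BD`. -/
lemma gelfand_ne_zero {g : BD G p hp} {c : ℝ} (hc : 0 < c) (hg : ∀ x, c ≤ (g : V → ℝ) x)
    (τ : Sp G p hp) : gelfand G g τ ≠ 0 := by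
  intro h0
  let k : BD G p hp := ⟨_, inv_max_mem_BD G g.2 hc⟩
  have hk : g * k = 1 := by
    ext x
    change (g : V → ℝ) x * (max ((g : V → ℝ) x) c)⁻¹ = 1
    rw [max_eq_left (hg x), mul_inv_cancel₀ (hc.trans_le (hg x)).ne']
  have := congrArg (fun f => gelfand G f τ) hk
  simp [h0] at this

/-- Characters of `BD_p(G)` take real values. -/
lemma gelfand_eq_re (f : BD G p hp) (τ : Sp G p hp) : gelfand G f τ = ((gelfand G f τ).re : ℂ) := by
  set z := gelfand G f τ with hz
  by_contra hne
  have him : z.im ≠ 0 := fun h => hne (Complex.ext (by simp) (by simp [h]))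
  -- The character sends a to i Im z, so it kills a² + (Im z)², although this function is bounded
  -- below by (Im z)² > 0.
  let a : BD G p hp := f - algebraMap ℝ _ z.re
  refine gelfand_ne_zero G (g := a * a + algebraMap ℝ _ (z.im ^ 2)) (c := z.im ^ 2) (by positivity)
    (fun x => ?_) τ ?_
  · change z.im ^ 2 ≤ (a : V → ℝ) x * (a : V → ℝ) x + z.im ^ 2
    nlinarith [mul_self_nonneg ((a : V → ℝ) x)]
  · have ha : gelfand G a τ = z.im * Complex.I := by
      simp only [a, gelfand_sub, gelfand_algebraMap, ← hz]
      nth_rewrite 1 [← Complex.re_add_im z]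
      ring
    rw [gelfand_add, gelfand_mul, ha, gelfand_algebraMap, mul_mul_mul_comm, Complex.I_mul_I]
    push_cast
    ring

/-- Elements of `BD_p(G)` have the value of their Gelfand transform. -/
lemma hasValueAt_of_gelfand_eq {f : BD G p hp} {τ : Sp G p hp} {a : ℝ}
    (h : gelfand G f τ = (a : ℂ)) : HasValueAt G (f : V → ℝ) τ a := by
  have h1 : Tendsto (fun v => gelfand G f (evalChar G p hp v)) (comap (evalChar G p hp) (𝓝 τ))
      (𝓝 (gelfand G f τ)) := ((continuous_gelfand G f).tendsto τ).comp tendsto_comap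
  have h2 := (Complex.continuous_re.tendsto _).comp h1
  rw [h] at h2
  exact h2

lemma IsBdd.tendsto_limUnder {f : V → ℝ} (hf : IsBdd f) (U : Ultrafilter V) :
    Tendsto f U (𝓝 (limUnder (U : Filter V) f)) := by
  obtain ⟨C, hC⟩ := hf
  obtain ⟨r, -, hr⟩ := (isCompact_Icc (a := -C) (b := C)).ultrafilter_le_nhds (U.map f)
    (le_principal_iff.2 (mem_map.2 (univ_mem' fun x => abs_le.1 (hC x))))
  exact tendsto_nhds_limUnder ⟨r, hr⟩

/-- The character `f ↦ lim_U f` given by an ultrafilter `U` on the vertices. -/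
def ultraChar (p : ℝ) (hp : 1 < p) (U : Ultrafilter V) : Sp G p hp :=
  Complex.ofRealAm.comp
    { toFun := fun f : BD G p hp => limUnder (U : Filter V) (f : V → ℝ)
      map_one' := tendsto_nhds_unique ((1 : BD G p hp).2.2.tendsto_limUnder U) tendsto_const_nhds
      map_zero' := tendsto_nhds_unique ((0 : BD G p hp).2.2.tendsto_limUnder U) tendsto_const_nhds
      map_mul' := fun f g => tendsto_nhds_unique ((f * g).2.2.tendsto_limUnder U)
        ((f.2.2.tendsto_limUnder U).mul (g.2.2.tendsto_limUnder U))
      map_add' := fun f g => tendsto_nhds_unique ((f + g).2.2.tendsto_limUnder U)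
        ((f.2.2.tendsto_limUnder U).add (g.2.2.tendsto_limUnder U))
      commutes' := fun r => tendsto_nhds_unique
        ((algebraMap ℝ (BD G p hp) r).2.2.tendsto_limUnder U) tendsto_const_nhds }

lemma gelfand_ultraChar (U : Ultrafilter V) (f : BD G p hp) :
    gelfand G f (ultraChar G p hp U) = (limUnder (U : Filter V) (f : V → ℝ) : ℝ) := rfl

lemma gelfand_ultraChar_eq {U : Ultrafilter V} {f : BD G p hp} {r : ℝ}
    (h : Tendsto (f : V → ℝ) U (𝓝 r)) : gelfand G f (ultraChar G p hp U) = r := by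
  rw [gelfand_ultraChar, h.limUnder_eq]

lemma tendsto_evalChar_ultraChar (U : Ultrafilter V) :
    Tendsto (evalChar G p hp) U (𝓝 (ultraChar G p hp U)) := by
  rw [nhds_induced, tendsto_comap_iff, tendsto_pi_nhds]
  intro f
  exact (Complex.continuous_ofReal.tendsto _).comp (f.2.2.tendsto_limUnder U)

variable (o : V)

/-- If a function tends to zero at the harmonic boundary, then the set where it is at least `ε` in
absolute value is capacitarily negligible at infinity. -/
lemma exists_mem_finSuppClosure_eq_one (hconn : G.Connected) {f : V → ℝ}
    (hf : ∀ τ ∈ harmonicBoundary G p hp o, HasValueAt G f τ 0) {ε : ℝ} (hε : 0 < ε) :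
    ∃ g ∈ finSuppClosure G p o, IsBdd g ∧ ∀ x, ε ≤ |f x| → g x = 1 := by
  have hp0 : 0 < p := by linarith
  let J : Set (BD G p hp) := {g | (g : V → ℝ) ∈ finSuppClosure G p o}
  have hJmul : ∀ w g : BD G p hp, g ∈ J → w * g ∈ J := fun w g hg =>
    mul_mem_finSuppClosure G o hconn hp w.2.1 w.2.2 hg g.2.2
  have hJadd : ∀ f g : BD G p hp, f ∈ J → g ∈ J → f + g ∈ J := fun f g hf hg =>
    add_mem_finSuppClosure G o hconn hp hf hg
  by_cases hex : ∃ g ∈ J, ∀ x, ε ≤ |f x| → 1 ≤ |(g : V → ℝ) x|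
  -- The function g² / max(g², 1) stays in the ideal and equals 1 wherever |g| ≥ 1.
  · obtain ⟨g, hgJ, hg⟩ := hex
    let k : BD G p hp := ⟨_, inv_max_mem_BD G (g * g).2 one_pos⟩
    refine ⟨((k * (g * g) : BD G p hp) : V → ℝ), hJmul _ _ (hJmul _ _ hgJ), (k * (g * g)).2.2,
      fun x hx => ?_⟩
    change (max ((g : V → ℝ) x * (g : V → ℝ) x) 1)⁻¹ * ((g : V → ℝ) x * (g : V → ℝ) x) = 1
    have h1 : 1 ≤ (g : V → ℝ) x * (g : V → ℝ) x := by
      rw [← abs_mul_abs_self]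
      nlinarith [hg x hx]
    rw [max_eq_left h1, inv_mul_cancel₀ (by linarith)]
  · exfalso
    push Not at hex
    let A : J → Set V := fun g => {x | ε ≤ |f x| ∧ |((g : BD G p hp) : V → ℝ) x| < 1}
    have hJ0 : (0 : BD G p hp) ∈ J :=
      mem_finSuppClosure_of_finite_support G o hp0 (f := 0) (by simp)
    have : Nonempty J := ⟨⟨0, hJ0⟩⟩
    -- Where g² + k² < 1, both |g| and |k| are below 1, so the sets `A g` form a filter base.
    have hdir : Directed (· ≥ ·) fun g : J => 𝓟 (A g) := by
      rintro ⟨g, hg⟩ ⟨k, hk⟩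
      refine ⟨⟨g * g + k * k, hJadd _ _ (hJmul _ _ hg) (hJmul _ _ hk)⟩, ?_, ?_⟩
      all_goals
        refine principal_mono.2 fun x hx => ⟨hx.1, ?_⟩
        have h2 := hx.2
        change |(g : V → ℝ) x * (g : V → ℝ) x + (k : V → ℝ) x * (k : V → ℝ) x| < 1 at h2
        have := (abs_lt.1 h2).2
        change |_| < _
        rw [← sq_lt_one_iff_abs_lt_one]
        nlinarith [mul_self_nonneg ((g : V → ℝ) x), mul_self_nonneg ((k : V → ℝ) x)]
    have : Nonempty V := ⟨o⟩
    have : NeBot (⨅ g : J, 𝓟 (A g)) := iInf_neBot_of_directed hdir fun g => by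
      obtain ⟨x, hx⟩ := hex g g.2
      exact principal_neBot_iff.2 ⟨x, hx⟩
    let U : Ultrafilter V := Ultrafilter.of (⨅ g : J, 𝓟 (A g))
    have hUA : ∀ g ∈ J, {x | ε ≤ |f x| ∧ |(g : V → ℝ) x| < 1} ∈ U := fun g hg =>
      Ultrafilter.of_le (⨅ g : J, 𝓟 (A g)) (mem_iInf_of_mem ⟨g, hg⟩ (mem_principal_self _))
    have hU0 : ∀ g ∈ J, gelfand G g (ultraChar G p hp U) = 0 := fun g hg => by
      have : Tendsto (g : V → ℝ) U (𝓝 0) := by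
        rw [Metric.tendsto_nhds]
        intro δ hδ
        -- The ideal is closed under scaling, which upgrades |g| < 1 along U to |g| < δ.
        have h1 : δ⁻¹ • g ∈ J := by
          rw [Algebra.smul_def]
          exact hJmul _ _ hg
        filter_upwards [hUA _ h1] with x hx
        have h2 := hx.2
        change |δ⁻¹ * (g : V → ℝ) x| < 1 at h2
        rw [abs_mul, abs_of_pos (inv_pos.2 hδ), inv_mul_lt_iff₀ hδ, mul_one] at h2
        simpa using h2
      rw [gelfand_ultraChar_eq G this, Complex.ofReal_zero]
    have hmem : ultraChar G p hp U ∈ harmonicBoundary G p hp o := by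
      refine ⟨?_, fun g hg => hU0 g hg⟩
      -- The indicator of x lies in the ideal but takes the value 1 at x, so the limit character is
      -- not a vertex.
      rintro ⟨x, hx⟩
      classical
      have hfin : (Function.support (Pi.single x (1 : ℝ))).Finite :=
        (Set.finite_singleton x).subset Pi.support_single_subset
      let d : BD G p hp := ⟨Pi.single x 1, DirichletFinite.of_finite_support G hp0 hfin, 1,
        fun y => by
          by_cases h : y = x
          · subst h; simp
          · simp [h]⟩
      have h1 := hU0 d (mem_finSuppClosure_of_finite_support G o hp0 hfin)
      rw [← hx, gelfand_evalChar] at h1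
      simp [d] at h1
    have hlim : Tendsto f U (𝓝 0) := (hf _ hmem).mono_left
      (tendsto_iff_comap.1 (tendsto_evalChar_ultraChar G U))
    obtain ⟨x, hx1, hx2⟩ := ((Metric.tendsto_nhds.1 hlim ε hε).and
      (show ∀ᶠ x in (U : Filter V), _ from hUA 0 hJ0)).exists
    rw [Real.dist_eq, sub_zero] at hx1
    linarith [hx2.1]

/-- Finitely many characters can be interpolated by elements of `BD_p(G)`. -/
lemma exists_gelfand_eq {ι : Type*} [Fintype ι] {x : ι → Sp G p hp}
    (hx : Function.Injective x) (a : ι → ℝ) : ∃ f : BD G p hp, ∀ i, gelfand G f (x i) = a i := by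
  classical
  have hsep : ∀ i j, i ≠ j → ∃ f : BD G p hp, gelfand G f (x i) = 1 ∧ gelfand G f (x j) = 0 := by
    intro i j hij
    have : ∃ f : BD G p hp, gelfand G f (x i) ≠ gelfand G f (x j) := by
      by_contra! h
      exact hij (hx (AlgHom.ext h))
    obtain ⟨f, hf⟩ := this
    have hi := gelfand_eq_re G f (x i)
    have hj := gelfand_eq_re G f (x j)
    set r := (gelfand G f (x i)).re
    set s := (gelfand G f (x j)).re
    have hrs : (r : ℂ) - s ≠ 0 := by
      rw [hi, hj] at hf
      exact sub_ne_zero.2 hf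
    refine ⟨(r - s)⁻¹ • (f - algebraMap ℝ _ s), ?_, ?_⟩
    · rw [gelfand_smul, gelfand_sub, gelfand_algebraMap, hi]
      push_cast
      exact inv_mul_cancel₀ hrs
    · rw [gelfand_smul, gelfand_sub, gelfand_algebraMap, hj, sub_self, mul_zero]
  choose! e he1 he0 using hsep
  have hprod : ∀ (s : Finset ι) (F : ι → BD G p hp) (τ : Sp G p hp),
      gelfand G (∏ j ∈ s, F j) τ = ∏ j ∈ s, gelfand G (F j) τ := fun s F τ => by
    unfold gelfand; exact map_prod _ _ _
  have hsum : ∀ (s : Finset ι) (F : ι → BD G p hp) (τ : Sp G p hp),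
      gelfand G (∑ j ∈ s, F j) τ = ∑ j ∈ s, gelfand G (F j) τ := fun s F τ => by
    unfold gelfand; exact map_sum _ _ _
  -- Lagrange interpolation: the i-th product is 1 at `x i` and 0 at the other points.
  refine ⟨∑ i, a i • ∏ j ∈ Finset.univ.erase i, e i j, fun k => ?_⟩
  rw [hsum, Finset.sum_eq_single k]
  · rw [gelfand_smul, hprod, Finset.prod_eq_one fun j hj => he1 k j (Finset.ne_of_mem_erase hj).symm,
      mul_one]
  · intro i _ hik
    rw [gelfand_smul, hprod, Finset.prod_eq_zero (Finset.mem_erase.2 ⟨hik.symm, Finset.mem_univ k⟩)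
      (he0 i k hik), mul_zero]
  · simp

end Characters

/-! ### Energy minimisation and the Dirichlet problem. -/

section Existence

variable {V : Type*} (G : SimpleGraph V) [G.LocallyFinite] {p : ℝ}

/-- Only edges at v change. The Dirichlet sum runs over ordered pairs, so each is counted once at v
and once at the neighbour, whence the factor 2. -/
lemma dirichletSum_add_single [DecidableEq V] (hp : 0 < p) {f : V → ℝ} (hf : DirichletFinite G p f)
    (v : V) (t : ℝ) :
    dirichletSum G p (f + Pi.single v t) = dirichletSum G p f +
      2 * ((∑ y ∈ G.neighborFinset v, |f y - f v - t| ^ p) -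
        ∑ y ∈ G.neighborFinset v, |f y - f v| ^ p) := by
  have hfin : (Function.support (Pi.single v t : V → ℝ)).Finite :=
    (Set.finite_singleton v).subset Pi.support_single_subset
  have hft : DirichletFinite G p (f + Pi.single v t) :=
    hf.add G hp (DirichletFinite.of_finite_support G hp hfin)
  set e : V → ℝ := fun y => |f y - f v - t| ^ p - |f y - f v| ^ p with he
  have hself : gradPow G p (f + Pi.single v t) v - gradPow G p f v =
      ∑ y ∈ G.neighborFinset v, e y := by
    rw [gradPow, gradPow, ← Finset.sum_sub_distrib]
    refine Finset.sum_congr rfl fun y hy => ?_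
    have hyv : y ≠ v := ((G.mem_neighborFinset v y).1 hy).ne'
    simp only [Pi.add_apply, Pi.single_eq_same, Pi.single_eq_of_ne hyv, he, add_zero, sub_sub]
  have hnbr : ∀ x ∈ G.neighborFinset v,
      gradPow G p (f + Pi.single v t) x - gradPow G p f x = e x := fun x hx => by
    have hvx : G.Adj v x := (G.mem_neighborFinset v x).1 hx
    rw [gradPow, gradPow, ← Finset.sum_sub_distrib, Finset.sum_eq_single v]
    · simp only [Pi.add_apply, Pi.single_eq_same, Pi.single_eq_of_ne hvx.ne', he, add_zero]
      rw [abs_sub_comm (f v + t), abs_sub_comm (f v), sub_sub]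
    · intro y _ hy
      simp [Pi.single_eq_of_ne hvx.ne', Pi.single_eq_of_ne hy]
    · intro h
      exact absurd ((G.mem_neighborFinset x v).2 hvx.symm) h
  have hout : ∀ x ∉ insert v (G.neighborFinset v),
      gradPow G p (f + Pi.single v t) x - gradPow G p f x = 0 := fun x hx => by
    simp only [Finset.mem_insert, SimpleGraph.mem_neighborFinset, not_or] at hx
    rw [gradPow, gradPow, ← Finset.sum_sub_distrib]
    refine Finset.sum_eq_zero fun y hy => ?_
    have hyv : y ≠ v := by
      rintro rfl
      exact hx.2 ((G.mem_neighborFinset x y).1 hy).symm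
    simp [Pi.single_eq_of_ne hx.1, Pi.single_eq_of_ne hyv]
  have h1 : dirichletSum G p (f + Pi.single v t) - dirichletSum G p f =
      ∑ x ∈ insert v (G.neighborFinset v),
        (gradPow G p (f + Pi.single v t) x - gradPow G p f x) := by
    rw [dirichletSum, dirichletSum, ← hft.tsum_sub hf]
    exact tsum_eq_sum hout
  rw [Finset.sum_insert (G.notMem_neighborFinset_self v), hself, Finset.sum_congr rfl hnbr] at h1
  rw [← Finset.sum_sub_distrib]
  linarith

/-- The Laplacian vanishes at a vertex where one-point perturbations do not lower the energy. -/
lemma pLaplacian_eq_zero_of_forall_le (hp : 1 < p) {h : V → ℝ} {v : V}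
    (hmin : ∀ t : ℝ, ∑ y ∈ G.neighborFinset v, |h y - h v| ^ p ≤
      ∑ y ∈ G.neighborFinset v, |h y - h v - t| ^ p) : pLaplacian G p h v = 0 := by
  have hd : HasDerivAt (fun t : ℝ => ∑ y ∈ G.neighborFinset v, |h y - h v - t| ^ p)
      (∑ y ∈ G.neighborFinset v, p * |h y - h v| ^ (p - 2) * (h y - h v) * (-1)) 0 := by
    refine HasDerivAt.fun_sum fun y _ => ?_
    have h1 : HasDerivAt (fun t : ℝ => h y - h v - t) (-1) 0 := by
      simpa using (hasDerivAt_id (0 : ℝ)).const_sub (h y - h v)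
    have h2 := hasDerivAt_abs_rpow (h y - h v - 0) hp
    have h3 := HasDerivAt.comp (0 : ℝ) h2 h1
    rw [sub_zero] at h3
    exact h3
  have h0 : IsLocalMin (fun t : ℝ => ∑ y ∈ G.neighborFinset v, |h y - h v - t| ^ p) 0 :=
    Eventually.of_forall fun t => by simpa using hmin t
  have hz := h0.hasDerivAt_eq_zero hd
  have e : ∑ y ∈ G.neighborFinset v, p * |h y - h v| ^ (p - 2) * (h y - h v) * (-1) =
      -p * pLaplacian G p h v := by
    rw [pLaplacian, Finset.mul_sum]
    exact Finset.sum_congr rfl fun y _ => by ring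
  rw [e, mul_eq_zero] at hz
  exact hz.resolve_left (by linarith)

/-- Royden decomposition: a bounded Dirichlet finite function is `p`-harmonic modulo the closure of
the finitely supported functions. -/
lemma exists_isPHarmonic_sub_mem_finSuppClosure [Countable V] {hp : 1 < p} (o : V)
    (f : BD G p hp) : ∃ h : BD G p hp, IsPHarmonic G p (h : V → ℝ) ∧
      ((h - f : BD G p hp) : V → ℝ) ∈ finSuppClosure G p o := by
  classical
  have hp0 : 0 < p := by linarith
  obtain ⟨hfD, M, hM⟩ := f.2
  have hM0 : 0 ≤ M := (abs_nonneg _).trans (hM o)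
  set F : V → ℝ := f.1 with hF
  let K : Set (V → ℝ) := {g | (Function.support (g - F)).Finite}
  have hKD : ∀ g ∈ K, DirichletFinite G p g := fun g hg => by
    have := (DirichletFinite.of_finite_support G hp0 hg).add G hp0 hfD
    rwa [sub_add_cancel] at this
  set m := sInf (dirichletSum G p '' K) with hm
  have hbdd : BddBelow (dirichletSum G p '' K) :=
    ⟨0, by rintro _ ⟨g, -, rfl⟩; exact dirichletSum_nonneg G g⟩
  have hmle : ∀ g ∈ K, m ≤ dirichletSum G p g := fun g hg => csInf_le hbdd ⟨g, hg, rfl⟩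
  have hseq : ∀ k : ℕ, ∃ g ∈ K, (∀ x, |g x| ≤ M) ∧
      dirichletSum G p g < m + 1 / ((k : ℝ) + 1) := fun k => by
    obtain ⟨_, ⟨g, hg, rfl⟩, hlt⟩ := exists_lt_of_csInf_lt
      (show (dirichletSum G p '' K).Nonempty from ⟨_, F, by simp [K], rfl⟩)
      (lt_add_of_pos_right m (Nat.one_div_pos_of_nat (α := ℝ) (n := k)))
    -- Clipping does not raise the energy and fixes the values of F, so it preserves membership in K
    -- and provides compactness.
    refine ⟨fun x => clip M (g x), ?_, fun x => abs_clip_le hM0 _,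
      (dirichletSum_le_of_abs_sub_le G hp0 (hKD g hg)
        fun x y => abs_clip_sub_clip_le M _ _).trans_lt hlt⟩
    refine hg.subset fun x hx hx0 => hx ?_
    rw [Pi.sub_apply, sub_eq_zero] at hx0
    simp only [Pi.sub_apply]
    rw [hx0, clip_of_abs_le (hM x), sub_self]
  choose g hgK hgM hgI using hseq
  obtain ⟨h, hh, φ, hφ, hlim⟩ := (isCompact_univ_pi fun _ : V =>
    isCompact_Icc (a := -M) (b := M)).tendsto_subseq
    (x := g) fun k x _ => abs_le.1 (hgM k x)
  rw [tendsto_pi_nhds] at hlim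
  have hone : ∀ k : ℕ, 1 / ((k : ℝ) + 1) ≤ 1 := fun k => by
    rw [div_le_one (by positivity)]
    linarith [(Nat.cast_nonneg k : (0 : ℝ) ≤ k)]
  have hu : h - F ∈ finSuppClosure G p o := by
    refine mem_finSuppClosure_of_tendsto G o hp (η := fun k => g (φ k) - F)
      (B := 2 ^ p * (m + 1 + dirichletSum G p F)) (fun k => hgK (φ k))
      (Eventually.of_forall fun k => (dirichletSum_sub_le G hp0 (hKD _ (hgK _)) hfD).trans ?_)
      fun x => (hlim x).sub_const (F x)
    have := hgI (φ k)
    have := hone (φ k)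
    gcongr
    linarith
  have hhD : DirichletFinite G p h := by
    have := hu.1.add G hp0 hfD
    rwa [sub_add_cancel] at this
  have hharm : IsPHarmonic G p h := fun v => by
    refine pLaplacian_eq_zero_of_forall_le G hp fun t => ?_
    have ht : ∀ s : ℝ, Tendsto
        (fun k => ∑ y ∈ G.neighborFinset v, |g (φ k) y - g (φ k) v - s| ^ p) atTop
        (𝓝 (∑ y ∈ G.neighborFinset v, |h y - h v - s| ^ p)) := fun s =>
      tendsto_finsetSum _ fun y _ => ((continuous_abs_rpow hp0).tendsto _).comp
        (((hlim y).sub (hlim v)).sub_const s)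
    have ht0 := ht 0
    simp only [sub_zero] at ht0
    have hone' : Tendsto (fun k => 1 / ((φ k : ℝ) + 1)) atTop (𝓝 0) :=
      tendsto_one_div_add_atTop_nhds_zero_nat.comp hφ.tendsto_atTop
    -- Minimality of h itself is not needed: a one-point variation involves finitely many values, so
    -- the almost-minimality of g (φ k) passes to the limit. The division by 2 undoes the double
    -- counting of edges.
    refine le_of_tendsto_of_tendsto' (ht0.sub ((hone'.div_const 2))) (ht t) (fun k => ?_)
      |>.trans' (by simp)
    have e := dirichletSum_add_single G hp0 (hKD _ (hgK (φ k))) v t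
    have hmem : g (φ k) + Pi.single v t ∈ K := by
      refine ((hgK (φ k)).union (Set.finite_singleton v)).subset fun x hx => ?_
      by_contra hc
      simp only [Set.mem_union, Function.mem_support, Set.mem_singleton_iff, not_or, not_not,
        Pi.sub_apply] at hc
      simp [Pi.single_eq_of_ne hc.2, hc.1] at hx
    have := hmle _ hmem
    have := hgI (φ k)
    linarith
  exact ⟨⟨h, hhD, M, fun x => abs_le.2 (hh x (Set.mem_univ x))⟩, hharm, hu⟩

/-- The Dirichlet problem on a finite part of the harmonic boundary. -/
lemma exists_isPHarmonic_gelfand_eq [Countable V] {hp : 1 < p} (o : V) {ι : Type*} [Fintype ι]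
    {x : ι → Sp G p hp} (hinj : Function.Injective x)
    (hx : ∀ i, x i ∈ harmonicBoundary G p hp o) (a : ι → ℝ) :
    ∃ h : BD G p hp, IsPHarmonic G p (h : V → ℝ) ∧ ∀ i, gelfand G h (x i) = (a i : ℂ) := by
  obtain ⟨f, hf⟩ := exists_gelfand_eq G hinj a
  obtain ⟨h, hh, hu⟩ := exists_isPHarmonic_sub_mem_finSuppClosure G o f
  refine ⟨h, hh, fun i => ?_⟩
  have := (hx i).2 _ hu
  rw [gelfand_sub, sub_eq_zero] at this
  rw [this, hf]

end Existence

/-! ### The Caccioppoli inequality on one edge. -/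

section EdgeEstimate

lemma oddPow_sub_mul_max_sub_nonneg {p : ℝ} (hp : 1 < p) {s t e a b : ℝ} (hst : s - t = b - a) :
    0 ≤ (oddPow p s - oddPow p t) * (max (b - e) 0 - max (a - e) 0) := by
  rcases le_total a b with h | h
  · refine mul_nonneg (sub_nonneg.2 ((strictMono_oddPow hp).monotone (by linarith)))
      (sub_nonneg.2 (max_le_max_right 0 (by linarith)))
  · refine mul_nonneg_of_nonpos_of_nonpos
      (sub_nonpos.2 ((strictMono_oddPow hp).monotone (by linarith)))
      (sub_nonpos.2 (max_le_max_right 0 (by linarith)))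

/-- The Caccioppoli inequality on a single edge. -/
lemma exists_edge_estimate {p M θ : ℝ} (hp : 1 < p) (hM : 0 < M) (hθ : 0 < θ) (hθ1 : θ ≤ 1) :
    ∃ C : ℝ, 0 ≤ C ∧ ∀ s t e a b α β : ℝ, s - t = b - a → a - e ≤ M → b - e ≤ M →
      0 ≤ α → α ≤ 1 → 0 ≤ β → β ≤ 1 →
      1 / 2 * (((if e < a then 1 else 0) * α ^ p + (if e < b then 1 else 0) * β ^ p) / 2 *
        ((oddPow p s - oddPow p t) * (max (b - e) 0 - max (a - e) 0))) ≤
      (oddPow p s - oddPow p t) * (max (b - e) 0 * β ^ p - max (a - e) 0 * α ^ p) + θ * |t| ^ p +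
        C * ((if e < a then 1 else 0) * (if e < b then 1 else 0) * |β - α|) ^ p := by
  have hp0 : 0 < p := by linarith
  -- The error term acquires a factor M * p, M from the size of the truncated difference and p from
  -- differentiating the power; dividing by 4 * M * p leaves θ / 4.
  obtain ⟨C, hC, hY⟩ := exists_abs_oddPow_sub_mul_le hp (show 0 < θ / (4 * M * p) by positivity)
  refine ⟨M * p * C, by positivity, fun s t e a b α β hst ha hb hα hα1 hβ hβ1 => ?_⟩
  have hsign := oddPow_sub_mul_max_sub_nonneg hp (e := e) hst
  have ht := Real.rpow_nonneg (abs_nonneg t) p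
  have hαp := Real.rpow_nonneg hα p
  have hβp := Real.rpow_nonneg hβ p
  have hαp1 := Real.rpow_le_one hα hα1 hp0.le
  have hβp1 := Real.rpow_le_one hβ hβ1 hp0.le
  set ψ := oddPow p s - oddPow p t with hψ
  set A := α ^ p
  set B := β ^ p
  have hθt : 0 ≤ θ * |t| ^ p := by positivity
  split_ifs with h1 h2 h2
  · rw [max_eq_left (by linarith : 0 ≤ b - e), max_eq_left (by linarith : 0 ≤ a - e)] at *
    rw [show b - e - (a - e) = s - t by linarith] at *
    have hmax : max α β ^ p ≤ A + B := by
      rcases max_choice α β with h | h <;> rw [h]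
      · exact le_add_of_nonneg_right hβp
      · exact le_add_of_nonneg_left hαp
    have e1 := abs_rpow_sub_rpow_le hp hα hβ
    have e2 := hY s t (max α β) |β - α| (le_max_of_le_left hα) (abs_nonneg _)
    rw [← hψ] at e2
    have e3 : |ψ * ((a - e + (b - e)) / 2 * (B - A))| ≤
        M * p * (|ψ| * (max α β ^ (p - 1) * |β - α|)) := by
      rw [abs_mul, abs_mul, abs_of_nonneg (by linarith : 0 ≤ (a - e + (b - e)) / 2)]
      calc _ ≤ |ψ| * (M * (p * (max α β ^ (p - 1) * |β - α|))) := by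
            gcongr
            linarith
        _ = _ := by ring
    have e4 := mul_le_mul_of_nonneg_left e2 (by positivity : 0 ≤ M * p)
    have e5 : M * p * (θ / (4 * M * p) * (max α β ^ p * (ψ * (s - t) + |t| ^ p))) ≤
        θ / 4 * ((A + B) * (ψ * (s - t) + |t| ^ p)) := by
      rw [show M * p * (θ / (4 * M * p) * (max α β ^ p * (ψ * (s - t) + |t| ^ p))) =
        θ / 4 * (max α β ^ p * (ψ * (s - t) + |t| ^ p)) by field_simp]
      gcongr
    -- As θ ≤ 1, the error consumes at most half of the main term; the other half is the left-hand
    -- side.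
    have e6 : θ * ((A + B) * (ψ * (s - t))) ≤ 1 * ((A + B) * (ψ * (s - t))) := by gcongr
    have e7 : θ * ((A + B) * |t| ^ p) ≤ θ * (2 * |t| ^ p) := by
      gcongr
      linarith
    have e8 := (abs_le.1 e3).1
    -- The symmetric discrete product rule: main term plus variation of the cutoff.
    have e9 : ψ * ((b - e) * B - (a - e) * A) =
        (A + B) / 2 * (ψ * (s - t)) + ψ * ((a - e + (b - e)) / 2 * (B - A)) := by
      rw [show s - t = b - a from hst]
      ring
    rw [e9]
    simp only [one_mul]
    linarith
  -- With one end below the level the test function vanishes there, and the cutoff's variation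
  -- produces no error.
  · rw [max_eq_right (by linarith : b - e ≤ 0), max_eq_left (by linarith : 0 ≤ a - e)] at *
    simp only [one_mul, zero_mul, mul_zero, Real.zero_rpow hp0.ne', add_zero, zero_sub] at *
    have := mul_nonneg hαp hsign
    nlinarith
  · rw [max_eq_left (by linarith : 0 ≤ b - e), max_eq_right (by linarith : a - e ≤ 0)] at *
    simp only [one_mul, zero_mul, mul_zero, Real.zero_rpow hp0.ne', add_zero, zero_add,
      sub_zero] at *
    have := mul_nonneg hβp hsign
    nlinarith
  · rw [max_eq_right (by linarith : b - e ≤ 0), max_eq_right (by linarith : a - e ≤ 0)] at *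
    simpa [Real.zero_rpow hp0.ne'] using hθt

end EdgeEstimate

/-! ### Comparison of two p-harmonic functions with equal boundary values. -/

section Uniqueness

open scoped Classical in
/-- Summation by parts for an antisymmetric, divergence free function on the edges. -/
lemma sum_adj_mul_sub_eq_zero {V : Type*} (G : SimpleGraph V) [G.LocallyFinite] {ψ : V → V → ℝ}
    (hanti : ∀ x y, ψ y x = -ψ x y) (hdiv : ∀ x, ∑ y ∈ G.neighborFinset x, ψ x y = 0)
    {v : V → ℝ} {F : Finset V} (hF : ∀ x ∈ F, v x ≠ 0 → G.neighborFinset x ⊆ F) :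
    ∑ x ∈ F, ∑ y ∈ F, (if G.Adj x y then ψ x y * (v y - v x) else 0) = 0 := by
  have h1 : ∑ x ∈ F, ∑ y ∈ F, (if G.Adj x y then ψ x y * v x else 0) = 0 := by
    refine Finset.sum_eq_zero fun x hx => ?_
    by_cases hv : v x = 0
    · simp [hv]
    · rw [← Finset.sum_filter]
      have : F.filter (fun y => G.Adj x y) = G.neighborFinset x := by
        ext y
        simp only [Finset.mem_filter, SimpleGraph.mem_neighborFinset, and_iff_right_iff_imp]
        exact fun hxy => hF x hx hv ((G.mem_neighborFinset x y).2 hxy)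
      rw [this, ← Finset.sum_mul, hdiv, zero_mul]
  have h2 : ∑ x ∈ F, ∑ y ∈ F, (if G.Adj x y then ψ x y * v y else 0) = 0 := by
    -- Exchanging x and y turns this sum into the negative of the previous one, by antisymmetry.
    rw [Finset.sum_comm, ← neg_eq_zero, ← Finset.sum_neg_distrib]
    refine (Finset.sum_congr rfl fun y _ => ?_).trans h1
    rw [← Finset.sum_neg_distrib]
    refine Finset.sum_congr rfl fun x _ => ?_
    rw [hanti y x, G.adj_comm]
    split_ifs <;> ring
  refine Eq.trans ?_ (sub_eq_zero.2 (h2.trans h1.symm))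
  rw [← Finset.sum_sub_distrib]
  refine Finset.sum_congr rfl fun x _ => ?_
  rw [← Finset.sum_sub_distrib]
  refine Finset.sum_congr rfl fun y _ => ?_
  split_ifs <;> ring

open scoped Classical in
lemma sum_adj_le_dirichletSum {V : Type*} (G : SimpleGraph V) [G.LocallyFinite] {p : ℝ}
    {f : V → ℝ} (hf : DirichletFinite G p f) (F : Finset V) :
    ∑ x ∈ F, ∑ y ∈ F, (if G.Adj x y then |f y - f x| ^ p else 0) ≤ dirichletSum G p f := by
  refine (Finset.sum_le_sum fun x _ => ?_).trans (sum_gradPow_le_dirichletSum G hf F)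
  rw [← Finset.sum_filter]
  refine Finset.sum_le_sum_of_subset_of_nonneg (fun y hy => ?_)
    fun y _ _ => Real.rpow_nonneg (abs_nonneg _) _
  exact (G.mem_neighborFinset x y).2 (Finset.mem_filter.1 hy).2

variable {V : Type*} (G : SimpleGraph V) [G.LocallyFinite] {p : ℝ} (o : V)

/-- If `h₁` and `h` are `p`-harmonic with bounded difference, `h` has finite energy and the set
where `h₁ - h > ε` is negligible at infinity, then `(h₁ - h - ε)⁺` is constant along edges. -/
lemma max_sub_eq_of_adj (hconn : G.Connected) (hp : 1 < p) {h₁ h : V → ℝ}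
    (hhD : DirichletFinite G p h) (hh₁ : IsPHarmonic G p h₁) (hh : IsPHarmonic G p h)
    {M : ℝ} (hM : ∀ x, |h₁ x - h x| ≤ M) {ε : ℝ} (hε : 0 < ε) {g : V → ℝ}
    (hg : g ∈ finSuppClosure G p o) (hg1 : ∀ x, ε < h₁ x - h x → g x = 1)
    {x₀ y₀ : V} (hxy : G.Adj x₀ y₀) :
    max (h₁ x₀ - h x₀ - ε) 0 = max (h₁ y₀ - h y₀ - ε) 0 := by
  classical
  have hp0 : 0 < p := by linarith
  have hM0 : 0 ≤ M := (abs_nonneg _).trans (hM o)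
  obtain ⟨η, hfin, hI, hη⟩ := exists_seq_of_mem_finSuppClosure G o hconn hp hg
  have hηD : ∀ k, DirichletFinite G p (η k - g) := fun k =>
    (DirichletFinite.of_finite_support G hp0 (hfin k)).sub G hp0 hg.1
  set f : V → ℝ := fun x => h₁ x - h x with hf
  let u : V → ℝ := fun x => max (f x - ε) 0
  let χ : V → ℝ := fun x => if ε < f x then 1 else 0
  let c : ℝ → ℝ := fun t => max 0 (min 1 t)
  have hc0 : ∀ t, 0 ≤ c t := fun t => le_max_left _ _
  have hc1 : ∀ t, c t ≤ 1 := fun t => max_le zero_le_one (min_le_left _ _)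
  have hcc : Continuous c := continuous_const.max (continuous_const.min continuous_id)
  have hcl : ∀ s t, |c s - c t| ≤ |s - t| := fun s t => by
    refine (abs_max_sub_max_le_max _ _ _ _).trans (max_le (by simp) ?_)
    exact (abs_min_sub_min_le_max _ _ _ _).trans (max_le (by simp) le_rfl)
  let ψ : V → V → ℝ := fun x y => oddPow p (h₁ y - h₁ x) - oddPow p (h y - h x)
  have hanti : ∀ x y, ψ y x = -ψ x y := fun x y => by
    simp only [ψ]
    rw [← neg_sub (h₁ y), ← neg_sub (h y), oddPow_neg, oddPow_neg]
    ring
  have hdiv : ∀ x, ∑ y ∈ G.neighborFinset x, ψ x y = 0 := fun x => by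
    have e1 : ∑ y ∈ G.neighborFinset x, oddPow p (h₁ y - h₁ x) = 0 := hh₁ x
    have e2 : ∑ y ∈ G.neighborFinset x, oddPow p (h y - h x) = 0 := hh x
    simp only [ψ]
    rw [Finset.sum_sub_distrib, e1, e2, sub_zero]
  have hdiff : ∀ x y, h₁ y - h₁ x - (h y - h x) = f y - f x := fun x y => by
    simp only [hf]; ring
  have hψu : ∀ x y, 0 ≤ ψ x y * (u y - u x) := fun x y =>
    oddPow_sub_mul_max_sub_nonneg hp (hdiff x y)
  let W : (V → ℝ) → V → V → ℝ := fun ζ x y => (χ x * c (ζ x) ^ p + χ y * c (ζ y) ^ p) / 2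
  have hχ0 : ∀ x, 0 ≤ χ x := fun x => by simp only [χ]; split_ifs <;> norm_num
  have hW0 : ∀ ζ x y, 0 ≤ W ζ x y := fun ζ x y =>
    div_nonneg (add_nonneg (mul_nonneg (hχ0 x) (Real.rpow_nonneg (hc0 _) _))
      (mul_nonneg (hχ0 y) (Real.rpow_nonneg (hc0 _) _))) (by norm_num)
  -- C depends on θ but not on k, so k → ∞ has to be taken before θ → 0.
  have hstep : ∀ θ : ℝ, 0 < θ → θ ≤ 1 → ∃ C : ℝ, ∀ k,
      1 / 2 * (W (η k) x₀ y₀ * (ψ x₀ y₀ * (u y₀ - u x₀))) ≤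
        θ * dirichletSum G p h + C * dirichletSum G p (η k - g) := by
    intro θ hθ hθ1
    obtain ⟨C, hC, hedge⟩ := exists_edge_estimate hp (show 0 < M + 1 by linarith) hθ hθ1
    refine ⟨C, fun k => ?_⟩
    let S : Finset V := (hfin k).toFinset
    -- F contains the neighbours of the support of η k, so summation by parts has no boundary term;
    -- x₀ and y₀ are added to capture the chosen edge.
    let F : Finset V := S ∪ S.biUnion (fun x => G.neighborFinset x) ∪ {x₀, y₀}
    let v : V → ℝ := fun x => u x * c (η k x) ^ p
    have hvF : ∀ x ∈ F, v x ≠ 0 → G.neighborFinset x ⊆ F := fun x _ hv y hy => by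
      have hxS : x ∈ S := by
        rw [Set.Finite.mem_toFinset, Function.mem_support]
        intro h0
        exact hv (by simp [v, h0, c, Real.zero_rpow hp0.ne'])
      exact Finset.mem_union_left _ (Finset.mem_union_right _ (Finset.mem_biUnion.2 ⟨x, hxS, hy⟩))
    have hgreen := sum_adj_mul_sub_eq_zero G hanti hdiv hvF
    have hle : ∀ x y, (if G.Adj x y then 1 / 2 * (W (η k) x y * (ψ x y * (u y - u x))) else 0) ≤
        (if G.Adj x y then ψ x y * (v y - v x) else 0) +
        θ * (if G.Adj x y then |h y - h x| ^ p else 0) +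
        C * (if G.Adj x y then |(η k - g) y - (η k - g) x| ^ p else 0) := fun x y => by
      split_ifs with hadj
      · refine (hedge _ _ ε (f x) (f y) (c (η k x)) (c (η k y)) (hdiff x y)
          (by linarith [(abs_le.1 (hM x)).2]) (by linarith [(abs_le.1 (hM y)).2])
          (hc0 _) (hc1 _) (hc0 _) (hc1 _)).trans ?_
        refine add_le_add le_rfl (mul_le_mul_of_nonneg_left ?_ hC)
        -- If both ends lie in {f > ε}, then g = 1 at both and subtracting g changes nothing;
        -- otherwise the left side is 0.
        have hχ : χ x * χ y * |c (η k y) - c (η k x)| ≤ |(η k - g) y - (η k - g) x| := by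
          simp only [χ]
          split_ifs with e1 e2 e2
          · rw [Pi.sub_apply, Pi.sub_apply, hg1 x e1, hg1 y e2, sub_sub_sub_cancel_right]
            simpa using hcl _ _
          all_goals simp
        exact Real.rpow_le_rpow (mul_nonneg (mul_nonneg (hχ0 x) (hχ0 y)) (abs_nonneg _)) hχ hp0.le
      · simp
    have hnn : ∀ x y,
        0 ≤ (if G.Adj x y then 1 / 2 * (W (η k) x y * (ψ x y * (u y - u x))) else 0) := fun x y => by
      split_ifs
      · exact mul_nonneg (by norm_num) (mul_nonneg (hW0 _ _ _) (hψu x y))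
      · exact le_rfl
    calc 1 / 2 * (W (η k) x₀ y₀ * (ψ x₀ y₀ * (u y₀ - u x₀)))
        = (if G.Adj x₀ y₀ then 1 / 2 * (W (η k) x₀ y₀ * (ψ x₀ y₀ * (u y₀ - u x₀))) else 0) := by
          rw [if_pos hxy]
      _ ≤ ∑ y ∈ F,
            (if G.Adj x₀ y then 1 / 2 * (W (η k) x₀ y * (ψ x₀ y * (u y - u x₀))) else 0) :=
          Finset.single_le_sum (f := fun y =>
            (if G.Adj x₀ y then 1 / 2 * (W (η k) x₀ y * (ψ x₀ y * (u y - u x₀))) else 0))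
            (fun y _ => hnn x₀ y) (by simp [F])
      _ ≤ ∑ x ∈ F, ∑ y ∈ F,
            (if G.Adj x y then 1 / 2 * (W (η k) x y * (ψ x y * (u y - u x))) else 0) :=
          Finset.single_le_sum (f := fun x => ∑ y ∈ F,
            (if G.Adj x y then 1 / 2 * (W (η k) x y * (ψ x y * (u y - u x))) else 0))
            (fun x _ => Finset.sum_nonneg fun y _ => hnn x y) (by simp [F])
      _ ≤ _ := Finset.sum_le_sum fun x _ => Finset.sum_le_sum fun y _ => hle x y
      _ ≤ _ := by
          simp only [Finset.sum_add_distrib, ← Finset.mul_sum]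
          rw [hgreen, zero_add]
          exact add_le_add
            (mul_le_mul_of_nonneg_left (sum_adj_le_dirichletSum G hhD F) hθ.le)
            (mul_le_mul_of_nonneg_left (sum_adj_le_dirichletSum G (hηD k) F) hC)
  have hlimit : ∀ θ : ℝ, 0 < θ → θ ≤ 1 →
      1 / 2 * (W g x₀ y₀ * (ψ x₀ y₀ * (u y₀ - u x₀))) ≤ θ * dirichletSum G p h := by
    intro θ hθ hθ1
    obtain ⟨C, hC⟩ := hstep θ hθ hθ1
    have hcp : ∀ x, Tendsto (fun k => c (η k x) ^ p) atTop (𝓝 (c (g x) ^ p)) := fun x =>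
      ((hcc.tendsto _).comp (hη x)).rpow_const (Or.inr hp0.le)
    have hWt : Tendsto (fun k => W (η k) x₀ y₀) atTop (𝓝 (W g x₀ y₀)) :=
      (((hcp x₀).const_mul _).add ((hcp y₀).const_mul _)).div_const 2
    have := (hI.const_mul C).const_add (θ * dirichletSum G p h)
    rw [mul_zero, add_zero] at this
    exact le_of_tendsto_of_tendsto' ((hWt.mul_const _).const_mul _) this hC
  have hzero : 1 / 2 * (W g x₀ y₀ * (ψ x₀ y₀ * (u y₀ - u x₀))) ≤ 0 := by
    have ht : Tendsto (fun θ : ℝ => θ * dirichletSum G p h) (𝓝[>] 0) (𝓝 0) := by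
      have : Tendsto (fun θ : ℝ => θ * dirichletSum G p h) (𝓝 0) (𝓝 (0 * dirichletSum G p h)) :=
        tendsto_id.mul_const _
      rw [zero_mul] at this
      exact this.mono_left nhdsWithin_le_nhds
    refine ge_of_tendsto ht ?_
    filter_upwards [Ioc_mem_nhdsGT (one_pos : (0 : ℝ) < 1)] with θ hθ
    exact hlimit θ hθ.1 hθ.2
  by_contra hne
  have hu : u x₀ ≠ u y₀ := hne
  have hfne : f x₀ ≠ f y₀ := fun h => hu (by simp only [u, h])
  have hψ0 : ψ x₀ y₀ ≠ 0 := fun h0 => hfne (by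
    have := (strictMono_oddPow hp).injective (sub_eq_zero.1 h0)
    linarith [hdiff x₀ y₀])
  have hpos : 0 < ψ x₀ y₀ * (u y₀ - u x₀) :=
    lt_of_le_of_ne (hψu _ _) (mul_ne_zero hψ0 (sub_ne_zero.2 hu.symm)).symm
  have hin : ∀ x, ε < f x → χ x * c (g x) ^ p = 1 := fun x hx => by
    simp [χ, hx, hg1 x hx, c]
  have hnn : ∀ x, 0 ≤ χ x * c (g x) ^ p := fun x =>
    mul_nonneg (hχ0 x) (Real.rpow_nonneg (hc0 _) _)
  -- An edge on which u varies has an end in {f > ε}, where the limiting weight is 1.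
  have hWpos : 0 < W g x₀ y₀ := by
    refine div_pos ?_ (by norm_num)
    by_cases hx : ε < f x₀
    · linarith [hin x₀ hx, hnn y₀]
    · by_cases hy : ε < f y₀
      · linarith [hin y₀ hy, hnn x₀]
      · exact absurd (by simp only [u]; rw [max_eq_right (by linarith), max_eq_right (by linarith)])
          hu
  have := mul_pos hWpos hpos
  linarith

lemma IsPHarmonic.neg {f : V → ℝ} (hf : IsPHarmonic G p f) : IsPHarmonic G p (-f) := fun x => by
  have h := hf x
  rw [pLaplacian] at h ⊢
  rw [← neg_eq_zero, ← h, ← Finset.sum_neg_distrib]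
  refine Finset.sum_congr rfl fun y _ => ?_
  rw [Pi.neg_apply, Pi.neg_apply, neg_sub_neg, abs_sub_comm]
  ring

/-- A bounded `p`-harmonic function is determined by its boundary values if these are the values of
a bounded `p`-harmonic function of finite energy. -/
lemma eq_of_hasValueAt_sub {hp : 1 < p} (hconn : G.Connected)
    (hne : (harmonicBoundary G p hp o).Nonempty) {h₁ : V → ℝ} (hb : IsBdd h₁)
    (hh₁ : IsPHarmonic G p h₁) (h : BD G p hp) (hh : IsPHarmonic G p (h : V → ℝ))
    (hval : ∀ τ ∈ harmonicBoundary G p hp o, HasValueAt G (h₁ - (h : V → ℝ)) τ 0) :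
    h₁ = h := by
  obtain ⟨hD, N, hN⟩ := h.2
  obtain ⟨M, hM⟩ := hb
  have hMN : ∀ x, |h₁ x - (h : V → ℝ) x| ≤ M + N := fun x =>
    (abs_sub _ _).trans (add_le_add (hM x) (hN x))
  have hpos : ∀ ε : ℝ, 0 < ε → ∀ x y, G.Adj x y →
      max (h₁ x - (h : V → ℝ) x - ε) 0 = max (h₁ y - (h : V → ℝ) y - ε) 0 := fun ε hε x y hxy => by
    obtain ⟨g, hg, -, hg1⟩ := exists_mem_finSuppClosure_eq_one G o hconn hval hε
    exact max_sub_eq_of_adj G o hconn hp hD hh₁ hh hMN hε hg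
      (fun z hz => hg1 z (hz.le.trans (le_abs_self _))) hxy
  have hneg : ∀ ε : ℝ, 0 < ε → ∀ x y, G.Adj x y →
      max ((h : V → ℝ) x - h₁ x - ε) 0 = max ((h : V → ℝ) y - h₁ y - ε) 0 := fun ε hε x y hxy => by
    obtain ⟨g, hg, -, hg1⟩ := exists_mem_finSuppClosure_eq_one G o hconn hval hε
    have := max_sub_eq_of_adj G o hconn hp (h₁ := -h₁) (h := -(h : V → ℝ)) (hD.neg G) (hh₁.neg G)
      (hh.neg G) (M := M + N) (ε := ε) (g := g) (fun z => ?_) hε hg (fun z hz => hg1 z ?_) hxy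
    · simpa only [Pi.neg_apply, neg_sub_neg] using this
    · rw [Pi.neg_apply, Pi.neg_apply, neg_sub_neg, abs_sub_comm]
      exact hMN z
    · rw [Pi.neg_apply, Pi.neg_apply, neg_sub_neg] at hz
      rw [Pi.sub_apply, abs_sub_comm]
      exact hz.le.trans (le_abs_self _)
  have hle : ∀ x y, G.Adj x y → h₁ x - (h : V → ℝ) x ≤ h₁ y - (h : V → ℝ) y := fun x y hxy => by
    by_contra! hlt
    -- A drop of the difference along an edge is detected by a positive level strictly between the
    -- two values, applied to the difference or to its negative.
    rcases le_or_gt (h₁ x - (h : V → ℝ) x) 0 with h0 | h0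
    · set a := (h : V → ℝ) y - h₁ y with ha
      set b := (h : V → ℝ) x - h₁ x with hb
      have hba : b < a := by linarith
      have := hneg ((a + b) / 2) (by linarith) x y hxy
      rw [max_eq_right (by linarith), max_eq_left (by linarith)] at this
      linarith
    · obtain ⟨ε, h1, h2⟩ := exists_between (max_lt h0 hlt)
      have := hpos ε ((le_max_left _ _).trans_lt h1) x y hxy
      rw [max_eq_left (by linarith),
        max_eq_right (by linarith [(le_max_right _ _).trans_lt h1])] at this
      linarith
  have hconst : ∀ x, h₁ x - (h : V → ℝ) x = h₁ o - (h : V → ℝ) o := fun x => by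
    have hwalk : ∀ {a b : V}, G.Walk a b →
        h₁ b - (h : V → ℝ) b = h₁ a - (h : V → ℝ) a := fun w => by
      induction w with
      | nil => rfl
      | cons hadj _ ih => rw [ih]; exact le_antisymm (hle _ _ hadj.symm) (hle _ _ hadj)
    obtain ⟨w⟩ := hconn.preconnected o x
    exact hwalk w
  -- At level |h₁ o - h o| the exceptional set is all of V, which forces g = 1; a point of the
  -- harmonic boundary sends 1 to 1, not to 0.
  have hz : h₁ o - (h : V → ℝ) o = 0 := by
    by_contra h0
    obtain ⟨g, hg, -, hg1⟩ := exists_mem_finSuppClosure_eq_one G o hconn hval (abs_pos.2 h0)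
    have hg' : g = ((1 : BD G p hp) : V → ℝ) := funext fun x =>
      hg1 x (by rw [Pi.sub_apply, hconst x])
    obtain ⟨τ, hτ⟩ := hne
    have := hτ.2 1 (hg' ▸ hg)
    rw [gelfand_one] at this
    exact one_ne_zero this
  exact funext fun x => by linarith [hconst x]

end Uniqueness

end PRoyden

end

theorem corollary2p5 {V : Type*} [Countable V] [Infinite V] (G : SimpleGraph V)
    [G.LocallyFinite] (hconn : G.Connected) (hdeg : PRoyden.BoundedDegree G)
    (p : ℝ) (hp : 1 < p) (o : V)
    (n : ℕ) (x : Fin n → PRoyden.Sp G p hp) (hinj : Function.Injective x)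
    (hx : Set.range x = PRoyden.harmonicBoundary G p hp o) :
    -- existence
    (∀ a : Fin n → ℝ, ∃ h : PRoyden.BD G p hp, PRoyden.IsPHarmonic G p (h : V → ℝ) ∧
      ∀ i, PRoyden.gelfand G h (x i) = (a i : ℂ) ∧ PRoyden.HasValueAt G (h : V → ℝ) (x i) (a i)) ∧
    -- uniqueness
    (0 < n →
      (∀ h₁ h₂ : PRoyden.BD G p hp,
        PRoyden.IsPHarmonic G p (h₁ : V → ℝ) → PRoyden.IsPHarmonic G p (h₂ : V → ℝ) →
        (∀ i, PRoyden.gelfand G h₁ (x i) = PRoyden.gelfand G h₂ (x i)) → h₁ = h₂) ∧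
      (∀ h₁ h₂ : V → ℝ, PRoyden.IsBdd h₁ → PRoyden.IsBdd h₂ →
        PRoyden.IsPHarmonic G p h₁ → PRoyden.IsPHarmonic G p h₂ →
        (∀ i, ∃ b : ℝ, PRoyden.HasValueAt G h₁ (x i) b ∧ PRoyden.HasValueAt G h₂ (x i) b) →
        h₁ = h₂)) := by

  have hmem : ∀ i, x i ∈ PRoyden.harmonicBoundary G p hp o := fun i => hx ▸ Set.mem_range_self i
  refine ⟨fun a => ?_, fun hn => ?_⟩
  · obtain ⟨h, hh, hv⟩ := PRoyden.exists_isPHarmonic_gelfand_eq G o hinj hmem a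
    exact ⟨h, hh, fun i => ⟨hv i, PRoyden.hasValueAt_of_gelfand_eq G (hv i)⟩⟩
  · have huniq : ∀ h₁ h₂ : V → ℝ, PRoyden.IsBdd h₁ → PRoyden.IsBdd h₂ →
        PRoyden.IsPHarmonic G p h₁ → PRoyden.IsPHarmonic G p h₂ →
        (∀ i, ∃ b : ℝ, PRoyden.HasValueAt G h₁ (x i) b ∧ PRoyden.HasValueAt G h₂ (x i) b) →
        h₁ = h₂ := by
      intro h₁ h₂ hb₁ hb₂ hh₁ hh₂ hval
      choose b hv₁ hv₂ using hval
      -- Neither h₁ nor h₂ need have finite energy, so both are compared with the finite-energy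
      -- solution that has the same values.
      obtain ⟨h, hh, hv⟩ := PRoyden.exists_isPHarmonic_gelfand_eq G o hinj hmem b
      have key : ∀ k : V → ℝ, PRoyden.IsBdd k → PRoyden.IsPHarmonic G p k →
          (∀ i, PRoyden.HasValueAt G k (x i) (b i)) → k = h := fun k hkb hk hkv => by
        refine PRoyden.eq_of_hasValueAt_sub G o hconn ⟨_, hmem ⟨0, hn⟩⟩ hkb hk h hh fun τ hτ => ?_
        rw [← hx] at hτ
        obtain ⟨i, rfl⟩ := hτ
        have := (hkv i).sub (PRoyden.hasValueAt_of_gelfand_eq G (hv i))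
        rwa [sub_self] at this
      rw [key h₁ hb₁ hh₁ hv₁, key h₂ hb₂ hh₂ hv₂]
    refine ⟨fun h₁ h₂ hh₁ hh₂ hval => ?_, huniq⟩
    refine Subtype.ext (huniq h₁ h₂ h₁.2.2 h₂.2.2 hh₁ hh₂ fun i => ?_)
    have hre := PRoyden.gelfand_eq_re G h₂ (x i)
    exact ⟨_, PRoyden.hasValueAt_of_gelfand_eq G ((hval i).trans hre),
      PRoyden.hasValueAt_of_gelfand_eq G hre⟩
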